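/- For $u\in L^2(\mathbb{R}^2)$ real valued, in coordinates $(\rho,\sigma)$, let $$H=\Big\{u\in H^1(\mathbb{R}^2):\ (\rho^2+\sigma^2)^{1/2}u\in L^2(\mathbb{R}^2),\ \|u\|_{L^2(\mathbb{R}^2)}=1\Big\},$$ and for $b\in\mathbb{R}$ let $$J(u,b)=\int_{\mathbb{R}^2}\Big(|\nabla u|^2+(4\rho^2+\sigma^2)u^2+\tfrac b2 u^4\Big)\,d\rho\,d\sigma ,\qquad u\in H .$$ A nonlinear ground state for the parameter $b$ is a pair $(v,E)$, where $v\in H$, $v\ge 0$ almost everywhere, $J(v,b)=\inf_{u\in H}J(u,b)$, and $E\in\mathbb{R}$ is its Lagrange multiplier, that is, $$-\Delta v+(4\rho^2+\sigma^2)v=E\,v-b\,v^3\quad\text{weakly on }\mathbb{R}^2 .$$ (i) There is a constant $c_0>0$ such that for all $a\in\mathbb{R}$ and $\kappa>0$ with $|a|\kappa^2\le c_0$ a nonlinear ground state for the parameter $b=a\kappa^2$ exists. (ii) Let $(v_0(b),E_0(b))$ be any choice of nonlinear ground states for the parameters $b$ in a neighbourhood of $0$. Then, as $b=a\kappa^2\to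 0$, $$v_0(b)\longrightarrow \frac{2^{1/4}}{\pi^{1/2}}\,e^{-(\rho^2+\frac12\sigma^2)}\quad\text{in }L^2(\mathbb{R}^2),\qquad E_0(b)=3+\frac{\sqrt2}{2\pi}\,b+o(b).$$ -/

import Mathlib

open MeasureTheory Filter Topology Asymptotics
open scoped ContDiff

noncomputable section

/-- Test functions on `ℝ²`: smooth and compactly supported. -/
def IsTestFunction (φ : ℝ × ℝ → ℝ) : Prop :=
  ContDiff ℝ ∞ φ ∧ HasCompactSupport φ

/-- `∂φ/∂ρ`, where `(ρ, σ)` are the coordinates of `ℝ²`. -/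
def dRho (φ : ℝ × ℝ → ℝ) (x : ℝ × ℝ) : ℝ := fderiv ℝ φ x (1, 0)

/-- `∂φ/∂σ`. -/
def dSigma (φ : ℝ × ℝ → ℝ) (x : ℝ × ℝ) : ℝ := fderiv ℝ φ x (0, 1)

/-- `(p, q)` is the weak (distributional) gradient of `u`. -/
def IsWeakGradient (u p q : ℝ × ℝ → ℝ) : Prop :=
  ∀ φ : ℝ × ℝ → ℝ, IsTestFunction φ →
    (∫ x, u x * dRho φ x = - ∫ x, p x * φ x) ∧
    (∫ x, u x * dSigma φ x = - ∫ x, q x * φ x)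

/-- The potential `4ρ² + σ²` of the operator `P₀ = -Δ + 4ρ² + σ²`. -/
def harmonicPotential (x : ℝ × ℝ) : ℝ := 4 * x.1 ^ 2 + x.2 ^ 2

/-- `u` belongs to `H = {u ∈ H¹(ℝ²) : (ρ² + σ²)^{1/2} u ∈ L²(ℝ²), ‖u‖_{L²} = 1}`, and its weak
gradient is `(p, q)`. -/
structure MemH (u p q : ℝ × ℝ → ℝ) : Prop where
  memLp : MemLp u 2 volume
  memLp_rho : MemLp p 2 volume
  memLp_sigma : MemLp q 2 volume
  weakGradient : IsWeakGradient u p q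
  memLp_weight : MemLp (fun x : ℝ × ℝ => √(x.1 ^ 2 + x.2 ^ 2) * u x) 2 volume
  norm_eq_one : eLpNorm u 2 volume = 1

/-- The functional `J(u, b) = ∫ (|∇u|² + (4ρ² + σ²) u² + (b / 2) u⁴)` for `u` with weak gradient
`(p, q)`; here `b = aκ²`. -/
def energyJ (b : ℝ) (u p q : ℝ × ℝ → ℝ) : ℝ :=
  ∫ x, (p x ^ 2 + q x ^ 2 + harmonicPotential x * u x ^ 2 + b / 2 * u x ^ 4)

/-- `v` (with weak gradient `(p, q)`) is a weak solution of `P₀ v = E v - b v³`. -/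
def IsWeakSolution (b E : ℝ) (v p q : ℝ × ℝ → ℝ) : Prop :=
  ∀ φ : ℝ × ℝ → ℝ, IsTestFunction φ →
    ∫ x, (p x * dRho φ x + q x * dSigma φ x + harmonicPotential x * v x * φ x) =
      ∫ x, (E * v x - b * v x ^ 3) * φ x

/-- `v` is a nonlinear ground state for the parameter `b = aκ²`, and `E` is its Lagrange multiplier:
`v` is a nonnegative minimizer of `J(·, b)` on `H`, and `P₀ v = E v - b v³`. -/
def IsGroundState (b : ℝ) (v : ℝ × ℝ → ℝ) (E : ℝ) : Prop :=
  (∀ᵐ x, 0 ≤ v x) ∧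
  ∃ p q : ℝ × ℝ → ℝ, MemH v p q ∧
    (∀ u p' q' : ℝ × ℝ → ℝ, MemH u p' q' → energyJ b v p q ≤ energyJ b u p' q') ∧
    IsWeakSolution b E v p q

/-- The Gaussian `2^{1/4} π^{-1/2} exp(-(ρ² + σ²/2))`. -/
def gaussianU0 (x : ℝ × ℝ) : ℝ :=
  (2 : ℝ) ^ (1 / 4 : ℝ) * Real.pi ^ (-(1 / 2) : ℝ) * Real.exp (-(x.1 ^ 2 + x.2 ^ 2 / 2))

end

/-! Write Q(u) = ∫ (|∇u|² + (4ρ² + σ²) u²), called `formEnergy`, so that J(u, b) = Q(u) + (b/2) ∫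
u⁴.

Existence is the direct method. In the plane Ladyzhenskaya's inequality ∫ u⁴ ≤ K ‖u‖² ‖∇u‖²
(`exists_integral_pow_four_le`) shows that for small |b| the quartic term is at most Q/2 on the unit
sphere of L², whatever the sign of b, so J is coercive (`exists_formEnergy_le_energyJ`). The
confining potential makes sets of bounded Q compact in L², and Q is weakly lower semicontinuous
(`exists_subseq_tendsto_of_formNormSq_le`). The same inequality applied to differences makes the
quartic term continuous along such sequences. Replacing u by |u| does not raise Q
(`FormDomain.exists_abs`), which gives a nonnegative minimiser, and a one-parameter variation gives
its Euler-Lagrange equation.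

For the asymptotics, annihilation operators factor the oscillator: Q(u) = ‖(∂_ρ + 2ρ)u‖² + ‖(∂_σ +
σ)u‖² + 3‖u‖² (`FormDomain.formEnergy_eq`). Thus Q ≥ 3 on H. If equality holds, exp(ρ² + σ²/2) u has
zero weak gradient and is constant, so the Gaussian is the only nonnegative normalised minimiser of
Q (`FormDomain.ae_eq_gaussianU0`).

Let M = √2/(2π) be the integral of the fourth power of the Gaussian. Comparing a ground state v with
the Gaussian gives 0 ≤ Q(v) - 3 ≤ (b/2)(M - ∫ v⁴), so Q(v) → 3 as b → 0. Compactness and uniqueness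
of the limit then give v → Gaussian in L² and ∫ v⁴ → M. Testing the equation with v itself gives E =
Q(v) + b ∫ v⁴ (`MemH.multiplier_eq`), hence E - 3 - Mb = (Q(v) - 3) + b(∫ v⁴ - M) = o(b). -/

noncomputable section

/-! ### Square-integrable functions: inequalities, limits and weak compactness -/

section SquareIntegrable

variable {α : Type*} [MeasurableSpace α] {μ : Measure α}

theorem inner_toLp_eq_integral {f g : α → ℝ} (hf : MemLp f 2 μ) (hg : MemLp g 2 μ) :
    inner ℝ (hf.toLp f) (hg.toLp g) = ∫ x, f x * g x ∂μ := by
  rw [L2.inner_def]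
  refine integral_congr_ae ?_
  filter_upwards [hf.coeFn_toLp, hg.coeFn_toLp] with x hx hy
  simp [hx, hy, mul_comm]

theorem norm_toLp_sq_eq_integral {f : α → ℝ} (hf : MemLp f 2 μ) :
    ‖hf.toLp f‖ ^ 2 = ∫ x, f x ^ 2 ∂μ := by
  rw [← real_inner_self_eq_norm_sq, inner_toLp_eq_integral]
  simp only [sq]

theorem MeasureTheory.MemLp.integrable_mul_two {f g : α → ℝ} (hf : MemLp f 2 μ)
    (hg : MemLp g 2 μ) : Integrable (fun x => f x * g x) μ :=
  hf.integrable_mul hg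

theorem MeasureTheory.MemLp.sub_two {f g : α → ℝ} (hf : MemLp f 2 μ)
    (hg : MemLp g 2 μ) : MemLp (fun x => f x - g x) 2 μ :=
  hf.sub hg

theorem sq_integral_mul_le {f g : α → ℝ} (hf : MemLp f 2 μ) (hg : MemLp g 2 μ) :
    (∫ x, f x * g x ∂μ) ^ 2 ≤ (∫ x, f x ^ 2 ∂μ) * ∫ x, g x ^ 2 ∂μ := by
  have h := real_inner_mul_inner_self_le (hf.toLp f) (hg.toLp g)
  simp only [inner_toLp_eq_integral, ← sq] at h
  exact h

theorem abs_integral_mul_le {f g : α → ℝ} (hf : MemLp f 2 μ) (hg : MemLp g 2 μ) :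
    |∫ x, f x * g x ∂μ| ≤ √(∫ x, f x ^ 2 ∂μ) * √(∫ x, g x ^ 2 ∂μ) := by
  rw [← Real.sqrt_mul (integral_nonneg fun x => sq_nonneg _)]
  exact Real.abs_le_sqrt (sq_integral_mul_le hf hg)

theorem integral_sq_add_le {f g : α → ℝ} (hf : MemLp f 2 μ) (hg : MemLp g 2 μ) :
    ∫ x, (f x + g x) ^ 2 ∂μ ≤ 2 * ∫ x, f x ^ 2 ∂μ + 2 * ∫ x, g x ^ 2 ∂μ := by
  rw [← integral_const_mul, ← integral_const_mul,
    ← integral_add (hf.integrable_sq.const_mul 2) (hg.integrable_sq.const_mul 2)]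
  refine integral_mono (hf.add hg).integrable_sq
    ((hf.integrable_sq.const_mul 2).add (hg.integrable_sq.const_mul 2)) fun x => ?_
  simp only
  nlinarith [sq_nonneg (f x - g x)]

theorem eLpNorm_two_eq_ofReal_sqrt_integral {f : α → ℝ} (hf : MemLp f 2 μ) :
    eLpNorm f 2 μ = ENNReal.ofReal (√(∫ x, f x ^ 2 ∂μ)) := by
  rw [hf.eLpNorm_eq_integral_rpow_norm (by norm_num) (by norm_num), Real.sqrt_eq_rpow]
  norm_num

theorem tendsto_eLpNorm_two_iff {ι : Type*} {l : Filter ι} {f : ι → α → ℝ}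
    (hf : ∀ n, MemLp (f n) 2 μ) :
    Tendsto (fun n => eLpNorm (f n) 2 μ) l (𝓝 0) ↔
      Tendsto (fun n => ∫ x, f n x ^ 2 ∂μ) l (𝓝 0) := by
  simp only [fun n => eLpNorm_two_eq_ofReal_sqrt_integral (hf n)]
  constructor
  · intro h
    have h1 := (ENNReal.tendsto_toReal ENNReal.zero_ne_top).comp h
    have h2 := h1.pow 2
    refine (h2.congr fun n => ?_).trans (by simp)
    simp [ENNReal.toReal_ofReal (Real.sqrt_nonneg _),
      Real.sq_sqrt (integral_nonneg fun x => sq_nonneg (f n x))]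
  · intro h
    have := ENNReal.tendsto_ofReal (h.sqrt)
    simpa using this

theorem tendsto_integral_mul_of_tendsto {ι : Type*} {l : Filter ι} {f g : ι → α → ℝ}
    {f₀ g₀ : α → ℝ} (hf : ∀ n, MemLp (f n) 2 μ) (hg : ∀ n, MemLp (g n) 2 μ)
    (hf₀ : MemLp f₀ 2 μ) (hg₀ : MemLp g₀ 2 μ)
    (hfl : Tendsto (fun n => ∫ x, (f n x - f₀ x) ^ 2 ∂μ) l (𝓝 0))
    (hgl : Tendsto (fun n => ∫ x, (g n x - g₀ x) ^ 2 ∂μ) l (𝓝 0)) :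
    Tendsto (fun n => ∫ x, f n x * g n x ∂μ) l (𝓝 (∫ x, f₀ x * g₀ x ∂μ)) := by
  have h1 := (tendsto_eLpNorm_two_iff fun n => (hf n).sub hf₀).2 hfl
  have h2 := (tendsto_eLpNorm_two_iff fun n => (hg n).sub hg₀).2 hgl
  rw [← Lp.tendsto_Lp_iff_tendsto_eLpNorm'' f hf f₀ hf₀] at h1
  rw [← Lp.tendsto_Lp_iff_tendsto_eLpNorm'' g hg g₀ hg₀] at h2
  simpa only [inner_toLp_eq_integral] using Filter.Tendsto.inner (𝕜 := ℝ) h1 h2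

theorem tendsto_integral_sq_of_tendsto {ι : Type*} {l : Filter ι} {f : ι → α → ℝ}
    {f₀ : α → ℝ} (hf : ∀ n, MemLp (f n) 2 μ) (hf₀ : MemLp f₀ 2 μ)
    (hfl : Tendsto (fun n => ∫ x, (f n x - f₀ x) ^ 2 ∂μ) l (𝓝 0)) :
    Tendsto (fun n => ∫ x, f n x ^ 2 ∂μ) l (𝓝 (∫ x, f₀ x ^ 2 ∂μ)) := by
  simpa only [sq] using tendsto_integral_mul_of_tendsto hf hf hf₀ hf₀ hfl hfl

theorem exists_subseq_tendsto_ae_of_tendsto {f : ℕ → α → ℝ}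
    {f₀ : α → ℝ} (hf : ∀ n, MemLp (f n) 2 μ) (hf₀ : MemLp f₀ 2 μ)
    (hfl : Tendsto (fun n => ∫ x, (f n x - f₀ x) ^ 2 ∂μ) atTop (𝓝 0)) :
    ∃ ns : ℕ → ℕ, StrictMono ns ∧
      ∀ᵐ x ∂μ, Tendsto (fun n => f (ns n) x) atTop (𝓝 (f₀ x)) := by
  have h1 := (tendsto_eLpNorm_two_iff fun n => (hf n).sub hf₀).2 hfl
  exact (tendstoInMeasure_of_tendsto_eLpNorm (by norm_num) (fun n => (hf n).1) hf₀.1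
    h1).exists_seq_tendsto_ae

/-- Weak sequential compactness of bounded sets in `L²`. -/
theorem exists_subseq_weakly_tendsto [IsSeparable μ] {f : ℕ → α → ℝ}
    (hf : ∀ n, MemLp (f n) 2 μ) {C : ℝ} (hC : ∀ n, ∫ x, f n x ^ 2 ∂μ ≤ C) :
    ∃ g : α → ℝ, MemLp g 2 μ ∧ ∃ ns : ℕ → ℕ, StrictMono ns ∧
      ∀ h : α → ℝ, MemLp h 2 μ →
        Tendsto (fun n => ∫ x, f (ns n) x * h x ∂μ) atTop (𝓝 (∫ x, g x * h x ∂μ)) := by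
  have : Fact ((2 : ENNReal) ≠ ⊤) := ⟨by norm_num⟩
  have : SecondCountableTopology (Lp ℝ 2 μ) := Lp.SecondCountableTopology
  -- The Riesz isomorphism moves the sequence to the dual, where closed balls are weak-*
  -- sequentially compact because `L²` is separable.
  let T : ℕ → WeakDual ℝ (Lp ℝ 2 μ) := fun n =>
    StrongDual.toWeakDual (InnerProductSpace.toDual ℝ (Lp ℝ 2 μ) ((hf n).toLp (f n)))
  have hT : ∀ n, T n ∈ WeakDual.toStrongDual ⁻¹'
      Metric.closedBall (0 : StrongDual ℝ (Lp ℝ 2 μ)) (√C) := by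
    intro n
    simp only [Set.mem_preimage, mem_closedBall_zero_iff]
    have : ‖InnerProductSpace.toDual ℝ (Lp ℝ 2 μ) ((hf n).toLp (f n))‖ ≤ √C := by
      rw [LinearIsometryEquiv.norm_map]
      exact Real.le_sqrt_of_sq_le ((norm_toLp_sq_eq_integral (hf n)).trans_le (hC n))
    exact this
  obtain ⟨a, -, ns, hns, hlim⟩ :=
    WeakDual.isSeqCompact_closedBall ℝ (Lp ℝ 2 μ) 0 (√C) hT
  let g := (InnerProductSpace.toDual ℝ (Lp ℝ 2 μ)).symm (WeakDual.toStrongDual a)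
  refine ⟨g, Lp.memLp g, ns, hns, fun h hh => ?_⟩
  have h1 := (WeakBilin.tendsto_iff_forall_eval_tendsto _
    (ContinuousLinearMap.coe_injective)).1 hlim (hh.toLp h)
  have h2 : ∀ n, (T (ns n)) (hh.toLp h) = ∫ x, f (ns n) x * h x ∂μ := fun n => by
    rw [← inner_toLp_eq_integral (hf _) hh]
    exact InnerProductSpace.toDual_apply_apply
  have h3 : a (hh.toLp h) = ∫ x, g x * h x ∂μ := by
    rw [← inner_toLp_eq_integral (Lp.memLp g) hh, Lp.toLp_coeFn]
    exact (InnerProductSpace.toDual_symm_apply (y := WeakDual.toStrongDual a)).symm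
  rw [← h3]
  simp only [← h2]
  exact h1

/-- Weak lower semicontinuity of the norm, from 2fg ≤ f² + g². Only the pairing with the limit
itself is needed. -/
theorem eventually_integral_sq_le_of_weakly_tendsto {f : ℕ → α → ℝ} {g : α → ℝ}
    (hf : ∀ n, MemLp (f n) 2 μ) (hg : MemLp g 2 μ)
    (h : Tendsto (fun n => ∫ x, f n x * g x ∂μ) atTop (𝓝 (∫ x, g x * g x ∂μ)))
    {δ : ℝ} (hδ : 0 < δ) : ∀ᶠ n in atTop, ∫ x, g x ^ 2 ∂μ ≤ ∫ x, f n x ^ 2 ∂μ + δ := by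
  have h1 : ∀ n, 2 * ∫ x, f n x * g x ∂μ ≤ ∫ x, f n x ^ 2 ∂μ + ∫ x, g x ^ 2 ∂μ := by
    intro n
    rw [← integral_const_mul, ← integral_add (hf n).integrable_sq hg.integrable_sq]
    refine integral_mono (((hf n).integrable_mul_two hg).const_mul 2)
      ((hf n).integrable_sq.add hg.integrable_sq) fun x => ?_
    simp only
    nlinarith [sq_nonneg (f n x - g x)]
  have h2 : ∀ᶠ n in atTop, ∫ x, g x * g x ∂μ - δ / 2 < ∫ x, f n x * g x ∂μ :=
    h.eventually_const_lt (by linarith)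
  filter_upwards [h2] with n hn
  have := h1 n
  simp only [← sq] at hn
  linarith

theorem lintegral_enorm_sq_eq_ofReal {f : α → ℝ} (hf : MemLp f 2 μ) :
    ∫⁻ x, ‖f x‖ₑ ^ 2 ∂μ = ENNReal.ofReal (∫ x, f x ^ 2 ∂μ) := by
  rw [ofReal_integral_eq_lintegral_ofReal hf.integrable_sq (ae_of_all _ fun x => sq_nonneg _)]
  refine lintegral_congr fun x => ?_
  rw [← ofReal_norm, ← ENNReal.ofReal_pow (norm_nonneg _), Real.norm_eq_abs, sq_abs]

theorem memLp_two_iff_lintegral_enorm_sq_lt_top {f : α → ℝ} (hf : AEStronglyMeasurable f μ) :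
    MemLp f 2 μ ↔ ∫⁻ x, ‖f x‖ₑ ^ 2 ∂μ < ⊤ := by
  rw [MemLp, and_iff_right hf, eLpNorm_lt_top_iff_lintegral_rpow_enorm_lt_top (by norm_num)
    (by norm_num)]
  norm_num

/-- Jensen's inequality followed by Tonelli's theorem. -/
theorem lintegral_enorm_sq_integral_le {β : Type*} [MeasurableSpace β] {ν : Measure β}
    [IsProbabilityMeasure ν] [SFinite μ] {F : α → β → ℝ}
    (hF : AEStronglyMeasurable (Function.uncurry F) (μ.prod ν)) :
    ∫⁻ x, ‖∫ y, F x y ∂ν‖ₑ ^ 2 ∂μ ≤ ∫⁻ y, ∫⁻ x, ‖F x y‖ₑ ^ 2 ∂μ ∂ν := by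
  rw [← lintegral_lintegral_swap (f := fun x y => ‖F x y‖ₑ ^ 2)
    (by exact hF.enorm.pow_const 2)]
  refine lintegral_mono_ae ?_
  filter_upwards [hF.prodMk_left] with x hx
  have h1 : ‖∫ y, F x y ∂ν‖ₑ ≤ eLpNorm (F x) 2 ν :=
    (enorm_integral_le_lintegral_enorm _).trans
      ((eLpNorm_one_eq_lintegral_enorm (f := F x) (μ := ν)).symm.le.trans
        (eLpNorm_le_eLpNorm_of_exponent_le (by norm_num) hx))
  calc ‖∫ y, F x y ∂ν‖ₑ ^ 2 ≤ eLpNorm (F x) 2 ν ^ 2 := by gcongr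
    _ = ∫⁻ y, ‖F x y‖ₑ ^ 2 ∂ν := by
      have := eLpNorm_nnreal_pow_eq_lintegral (f := F x) (μ := ν) (p := 2) (by norm_num)
      simpa using this

end SquareIntegrable

/-! ### Test functions, weak derivatives and the form domain -/

namespace IsTestFunction

theorem memLp {φ : ℝ × ℝ → ℝ} (h : IsTestFunction φ) (p : ENNReal) : MemLp φ p volume :=
  h.1.continuous.memLp_of_hasCompactSupport h.2

theorem differentiable {φ : ℝ × ℝ → ℝ} (h : IsTestFunction φ) : Differentiable ℝ φ :=
  h.1.differentiable (by norm_num)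

theorem fderiv_apply {φ : ℝ × ℝ → ℝ} (h : IsTestFunction φ) (e : ℝ × ℝ) :
    IsTestFunction (fun x => fderiv ℝ φ x e) :=
  ⟨(h.1.fderiv_right (m := ∞) (by norm_num)).clm_apply contDiff_const, h.2.fderiv_apply ℝ e⟩

theorem dRho {φ : ℝ × ℝ → ℝ} (h : IsTestFunction φ) : IsTestFunction (dRho φ) :=
  h.fderiv_apply (1, 0)

theorem dSigma {φ : ℝ × ℝ → ℝ} (h : IsTestFunction φ) : IsTestFunction (dSigma φ) :=
  h.fderiv_apply (0, 1)

theorem smooth_mul {φ g : ℝ × ℝ → ℝ} (h : IsTestFunction φ) (hg : ContDiff ℝ ∞ g) :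
    IsTestFunction (fun x => g x * φ x) :=
  ⟨hg.mul h.1, h.2.mul_left⟩

theorem continuous_mul_memLp {φ g : ℝ × ℝ → ℝ} (h : IsTestFunction φ) (hg : Continuous g)
    (p : ENNReal) : MemLp (fun x => g x * φ x) p volume :=
  (hg.mul h.1.continuous).memLp_of_hasCompactSupport h.2.mul_left

theorem exists_bound {φ : ℝ × ℝ → ℝ} (h : IsTestFunction φ) : ∃ M : ℝ, 0 ≤ M ∧ ∀ x, |φ x| ≤ M := by
  obtain ⟨M, hM⟩ := h.1.continuous.bounded_above_of_compact_support h.2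
  exact ⟨M, (norm_nonneg _).trans (hM 0), hM⟩

theorem mul_memLp {φ f : ℝ × ℝ → ℝ} (h : IsTestFunction φ) (hf : MemLp f 2 volume) :
    MemLp (fun x => φ x * f x) 2 volume :=
  hf.mul (h.memLp ⊤)

end IsTestFunction

/-- `p` is the weak derivative of `u` in the direction `e`. -/
def IsWeakDeriv (e : ℝ × ℝ) (u p : ℝ × ℝ → ℝ) : Prop :=
  ∀ φ : ℝ × ℝ → ℝ, IsTestFunction φ → ∫ x, u x * fderiv ℝ φ x e = - ∫ x, p x * φ x

theorem isWeakGradient_iff {u p q : ℝ × ℝ → ℝ} :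
    IsWeakGradient u p q ↔ IsWeakDeriv (1, 0) u p ∧ IsWeakDeriv (0, 1) u q :=
  ⟨fun h => ⟨fun φ hφ => (h φ hφ).1, fun φ hφ => (h φ hφ).2⟩,
    fun h φ hφ => ⟨h.1 φ hφ, h.2 φ hφ⟩⟩

namespace IsWeakDeriv

variable {e : ℝ × ℝ} {u p u' p' : ℝ × ℝ → ℝ}

theorem congr_ae (h : IsWeakDeriv e u p) (hu : u =ᵐ[volume] u') : IsWeakDeriv e u' p := by
  intro φ hφ
  rw [← h φ hφ]
  refine integral_congr_ae ?_
  filter_upwards [hu] with x hx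
  rw [hx]

theorem add (h : IsWeakDeriv e u p) (h' : IsWeakDeriv e u' p') (hu : MemLp u 2 volume)
    (hp : MemLp p 2 volume) (hu' : MemLp u' 2 volume) (hp' : MemLp p' 2 volume) :
    IsWeakDeriv e (fun x => u x + u' x) (fun x => p x + p' x) := by
  intro φ hφ
  have hd := (hφ.fderiv_apply e).memLp 2
  have hm := hφ.memLp 2
  simp only [add_mul]
  rw [integral_add (hu.integrable_mul_two hd) (hu'.integrable_mul_two hd),
    integral_add (hp.integrable_mul_two hm) (hp'.integrable_mul_two hm), h φ hφ, h' φ hφ]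
  ring

theorem const_mul (h : IsWeakDeriv e u p) (c : ℝ) :
    IsWeakDeriv e (fun x => c * u x) (fun x => c * p x) := by
  intro φ hφ
  simp only [mul_assoc, integral_const_mul, h φ hφ]
  ring

theorem _root_.IsTestFunction.isWeakDeriv {ψ : ℝ × ℝ → ℝ} (hψ : IsTestFunction ψ) :
    IsWeakDeriv e ψ (fun x => fderiv ℝ ψ x e) := by
  intro φ hφ
  exact integral_mul_fderiv_eq_neg_fderiv_mul_of_integrable
    (((hψ.fderiv_apply e).memLp 2).integrable_mul_two (hφ.memLp 2))
    ((hψ.memLp 2).integrable_mul_two ((hφ.fderiv_apply e).memLp 2))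
    ((hψ.memLp 2).integrable_mul_two (hφ.memLp 2))
    (fun x _ => hψ.differentiable x) (fun x _ => hφ.differentiable x)

/-- Leibniz rule for the product of a weakly differentiable and a smooth function. -/
theorem smooth_mul (h : IsWeakDeriv e u p) {χ : ℝ × ℝ → ℝ} (hχ : ContDiff ℝ ∞ χ)
    (hu : LocallyIntegrable u volume) (hp : LocallyIntegrable p volume) :
    IsWeakDeriv e (fun x => χ x * u x) (fun x => χ x * p x + fderiv ℝ χ x e * u x) := by
  intro φ hφ
  have hχd : Continuous fun x => fderiv ℝ χ x e :=
    ((hχ.fderiv_right (m := ∞) (by norm_num)).clm_apply contDiff_const).continuous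
  have key : ∀ (w g ψ : ℝ × ℝ → ℝ), LocallyIntegrable w volume → Continuous g →
      IsTestFunction ψ → Integrable (fun x => w x * (g x * ψ x)) := by
    intro w g ψ hw hg hψ
    have := hw.integrable_smul_right_of_hasCompactSupport (hg.mul hψ.1.continuous) hψ.2.mul_left
    simpa only [smul_eq_mul, Pi.mul_apply] using this
  have h1 := h _ (hφ.smooth_mul hχ)
  have h2 : ∀ x, fderiv ℝ (fun x => χ x * φ x) x e =
      χ x * fderiv ℝ φ x e + fderiv ℝ χ x e * φ x := by
    intro x
    rw [fderiv_fun_mul (hχ.differentiable (by norm_num) x) (hφ.differentiable x)]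
    simp [mul_comm]
  simp only [h2, mul_add] at h1
  rw [integral_add (key _ _ _ hu hχ.continuous (hφ.fderiv_apply e)) (key _ _ _ hu hχd hφ)] at h1
  have h3 : ∫ x, (χ x * p x + fderiv ℝ χ x e * u x) * φ x =
      (∫ x, p x * (χ x * φ x)) + ∫ x, u x * (fderiv ℝ χ x e * φ x) := by
    rw [← integral_add (key _ _ _ hp hχ.continuous hφ) (key _ _ _ hu hχd hφ)]
    exact integral_congr_ae (ae_of_all _ fun x => by ring)
  have h4 : ∫ x, χ x * u x * fderiv ℝ φ x e = ∫ x, u x * (χ x * fderiv ℝ φ x e) :=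
    integral_congr_ae (ae_of_all _ fun x => by ring)
  rw [h3, h4]
  linarith

end IsWeakDeriv

/-- The form domain of the operator `-Δ + 4ρ² + σ²`: `u`, its weak gradient `(p, q)` and
`(ρ² + σ²)^{1/2} u` are square integrable. -/
structure FormDomain (u p q : ℝ × ℝ → ℝ) : Prop where
  memLp : MemLp u 2 volume
  memLp_rho : MemLp p 2 volume
  memLp_sigma : MemLp q 2 volume
  weakDeriv_rho : IsWeakDeriv (1, 0) u p
  weakDeriv_sigma : IsWeakDeriv (0, 1) u q
  memLp_weight : MemLp (fun x : ℝ × ℝ => √(x.1 ^ 2 + x.2 ^ 2) * u x) 2 volume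

theorem MemH.formDomain {u p q : ℝ × ℝ → ℝ} (h : MemH u p q) : FormDomain u p q :=
  ⟨h.memLp, h.memLp_rho, h.memLp_sigma, (isWeakGradient_iff.1 h.weakGradient).1,
    (isWeakGradient_iff.1 h.weakGradient).2, h.memLp_weight⟩

theorem MemH.integral_sq_eq_one {u p q : ℝ × ℝ → ℝ} (h : MemH u p q) : ∫ x, u x ^ 2 = 1 := by
  have h1 := h.norm_eq_one
  rw [eLpNorm_two_eq_ofReal_sqrt_integral h.memLp, ENNReal.ofReal_eq_one, Real.sqrt_eq_one] at h1
  exact h1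

theorem FormDomain.memH {u p q : ℝ × ℝ → ℝ} (h : FormDomain u p q) (h1 : ∫ x, u x ^ 2 = 1) :
    MemH u p q :=
  ⟨h.memLp, h.memLp_rho, h.memLp_sigma, isWeakGradient_iff.2 ⟨h.weakDeriv_rho, h.weakDeriv_sigma⟩,
    h.memLp_weight, by rw [eLpNorm_two_eq_ofReal_sqrt_integral h.memLp, h1]; simp⟩

theorem continuous_harmonicPotential : Continuous harmonicPotential := by
  unfold harmonicPotential
  fun_prop

theorem harmonicPotential_nonneg (x : ℝ × ℝ) : 0 ≤ harmonicPotential x := by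
  unfold harmonicPotential
  positivity

theorem radius_sq_le_harmonicPotential (x : ℝ × ℝ) : x.1 ^ 2 + x.2 ^ 2 ≤ harmonicPotential x := by
  unfold harmonicPotential
  nlinarith [sq_nonneg x.1]

theorem harmonicPotential_le (x : ℝ × ℝ) : harmonicPotential x ≤ 4 * (x.1 ^ 2 + x.2 ^ 2) := by
  unfold harmonicPotential
  nlinarith [sq_nonneg x.2]

theorem memLp_mul_of_sq_le {u a b : ℝ × ℝ → ℝ} (C : ℝ) (hu : MemLp u 2 volume) (ha : Continuous a)
    (hab : ∀ x, a x ^ 2 ≤ C ^ 2 * b x ^ 2) (h : MemLp (fun x => b x * u x) 2 volume) :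
    MemLp (fun x => a x * u x) 2 volume := by
  refine h.of_le_mul (c := |C|) (ha.aestronglyMeasurable.mul hu.1) (ae_of_all _ fun x => ?_)
  rw [Real.norm_eq_abs, Real.norm_eq_abs, ← abs_mul]
  refine sq_le_sq.1 ?_
  have := mul_le_mul_of_nonneg_right (hab x) (sq_nonneg (u x))
  nlinarith

theorem continuous_sqrt_harmonicPotential : Continuous fun x => √(harmonicPotential x) :=
  continuous_harmonicPotential.sqrt

/-- The weights are comparable: ρ² + σ² ≤ 4ρ² + σ² ≤ 4(ρ² + σ²). The right-hand weight is preferred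
below because it turns the potential energy into a squared `L²` norm. -/
theorem memLp_weight_iff {u : ℝ × ℝ → ℝ} (hu : MemLp u 2 volume) :
    MemLp (fun x : ℝ × ℝ => √(x.1 ^ 2 + x.2 ^ 2) * u x) 2 volume ↔
      MemLp (fun x => √(harmonicPotential x) * u x) 2 volume := by
  constructor
  · refine memLp_mul_of_sq_le 2 hu continuous_sqrt_harmonicPotential fun x => ?_
    rw [Real.sq_sqrt (harmonicPotential_nonneg x), Real.sq_sqrt (by positivity)]
    have := harmonicPotential_le x
    linarith
  · refine memLp_mul_of_sq_le 1 hu (by fun_prop) fun x => ?_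
    rw [Real.sq_sqrt (harmonicPotential_nonneg x), Real.sq_sqrt (by positivity)]
    have := radius_sq_le_harmonicPotential x
    linarith

namespace FormDomain

variable {u p q u' p' q' : ℝ × ℝ → ℝ}

theorem memLp_potential (h : FormDomain u p q) :
    MemLp (fun x => √(harmonicPotential x) * u x) 2 volume :=
  (memLp_weight_iff h.memLp).1 h.memLp_weight

theorem sqrt_potential_mul_sq (u : ℝ × ℝ → ℝ) (x : ℝ × ℝ) :
    (√(harmonicPotential x) * u x) ^ 2 = harmonicPotential x * u x ^ 2 := by
  rw [mul_pow, Real.sq_sqrt (harmonicPotential_nonneg x)]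

theorem integrable_potential (h : FormDomain u p q) :
    Integrable fun x => harmonicPotential x * u x ^ 2 := by
  simpa only [sqrt_potential_mul_sq] using h.memLp_potential.integrable_sq

theorem memLp_fst_mul (h : FormDomain u p q) : MemLp (fun x => x.1 * u x) 2 volume := by
  refine memLp_mul_of_sq_le 1 h.memLp continuous_fst (fun x => ?_) h.memLp_weight
  rw [Real.sq_sqrt (by positivity)]
  nlinarith [sq_nonneg x.2]

theorem memLp_snd_mul (h : FormDomain u p q) : MemLp (fun x => x.2 * u x) 2 volume := by
  refine memLp_mul_of_sq_le 1 h.memLp continuous_snd (fun x => ?_) h.memLp_weight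
  rw [Real.sq_sqrt (by positivity)]
  nlinarith [sq_nonneg x.1]

theorem add (h : FormDomain u p q) (h' : FormDomain u' p' q') :
    FormDomain (fun x => u x + u' x) (fun x => p x + p' x) (fun x => q x + q' x) where
  memLp := h.memLp.add h'.memLp
  memLp_rho := h.memLp_rho.add h'.memLp_rho
  memLp_sigma := h.memLp_sigma.add h'.memLp_sigma
  weakDeriv_rho := h.weakDeriv_rho.add h'.weakDeriv_rho h.memLp h.memLp_rho h'.memLp h'.memLp_rho
  weakDeriv_sigma :=
    h.weakDeriv_sigma.add h'.weakDeriv_sigma h.memLp h.memLp_sigma h'.memLp h'.memLp_sigma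
  memLp_weight := by
    simp only [mul_add]
    exact h.memLp_weight.add h'.memLp_weight

theorem const_mul (h : FormDomain u p q) (c : ℝ) :
    FormDomain (fun x => c * u x) (fun x => c * p x) (fun x => c * q x) where
  memLp := h.memLp.const_mul c
  memLp_rho := h.memLp_rho.const_mul c
  memLp_sigma := h.memLp_sigma.const_mul c
  weakDeriv_rho := h.weakDeriv_rho.const_mul c
  weakDeriv_sigma := h.weakDeriv_sigma.const_mul c
  memLp_weight := by
    simp only [mul_left_comm _ c]
    exact h.memLp_weight.const_mul c

theorem sub (h : FormDomain u p q) (h' : FormDomain u' p' q') :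
    FormDomain (fun x => u x - u' x) (fun x => p x - p' x) (fun x => q x - q' x) := by
  have := h.add (h'.const_mul (-1))
  simpa only [neg_mul, one_mul, ← sub_eq_add_neg] using this

theorem _root_.IsTestFunction.formDomain {φ : ℝ × ℝ → ℝ} (h : IsTestFunction φ) :
    FormDomain φ (dRho φ) (dSigma φ) where
  memLp := h.memLp 2
  memLp_rho := h.dRho.memLp 2
  memLp_sigma := h.dSigma.memLp 2
  weakDeriv_rho := h.isWeakDeriv
  weakDeriv_sigma := h.isWeakDeriv
  memLp_weight := h.continuous_mul_memLp (by fun_prop) 2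

theorem test_mul (h : FormDomain u p q) {χ : ℝ × ℝ → ℝ} (hχ : IsTestFunction χ) :
    FormDomain (fun x => χ x * u x) (fun x => χ x * p x + dRho χ x * u x)
      (fun x => χ x * q x + dSigma χ x * u x) where
  memLp := hχ.mul_memLp h.memLp
  memLp_rho := (hχ.mul_memLp h.memLp_rho).add (hχ.dRho.mul_memLp h.memLp)
  memLp_sigma := (hχ.mul_memLp h.memLp_sigma).add (hχ.dSigma.mul_memLp h.memLp)
  weakDeriv_rho := h.weakDeriv_rho.smooth_mul hχ.1 (h.memLp.locallyIntegrable (by norm_num))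
    (h.memLp_rho.locallyIntegrable (by norm_num))
  weakDeriv_sigma := h.weakDeriv_sigma.smooth_mul hχ.1 (h.memLp.locallyIntegrable (by norm_num))
    (h.memLp_sigma.locallyIntegrable (by norm_num))
  memLp_weight := by
    simp only [mul_left_comm _ (χ _)]
    exact hχ.mul_memLp h.memLp_weight

end FormDomain

/-! ### Mollification -/

/-- The convolution of `f` with the normalised bump function `η`. -/
def mollify (η : ContDiffBump (0 : ℝ × ℝ)) (f : ℝ × ℝ → ℝ) (x : ℝ × ℝ) : ℝ :=
  ∫ y, η.normed volume y * f (x - y)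

theorem mollify_eq_convolution (η : ContDiffBump (0 : ℝ × ℝ)) (f : ℝ × ℝ → ℝ) :
    mollify η f = convolution (η.normed volume) f (ContinuousLinearMap.lsmul ℝ ℝ) volume := by
  ext x
  simp [mollify, convolution_def]

theorem ContDiffBump.isTestFunction_normed (η : ContDiffBump (0 : ℝ × ℝ)) :
    IsTestFunction (η.normed volume) :=
  ⟨η.contDiff_normed, η.hasCompactSupport_normed⟩

theorem IsTestFunction.comp_const_sub {φ : ℝ × ℝ → ℝ} (h : IsTestFunction φ) (x : ℝ × ℝ) :
    IsTestFunction (fun y => φ (x - y)) :=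
  ⟨h.1.comp (contDiff_const.sub contDiff_id),
    h.2.comp_homeomorph (Homeomorph.subLeft x)⟩

theorem mollify_eq_integral_swap (η : ContDiffBump (0 : ℝ × ℝ)) (f : ℝ × ℝ → ℝ) (x : ℝ × ℝ) :
    mollify η f x = ∫ y, f y * η.normed volume (x - y) := by
  unfold mollify
  rw [← integral_sub_left_eq_self (fun y => η.normed volume y * f (x - y)) volume x]
  exact integral_congr_ae (ae_of_all _ fun y => by simp [mul_comm])

theorem contDiff_mollify (η : ContDiffBump (0 : ℝ × ℝ)) {f : ℝ × ℝ → ℝ}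
    (hf : LocallyIntegrable f volume) : ContDiff ℝ ∞ (mollify η f) := by
  rw [mollify_eq_convolution]
  exact η.hasCompactSupport_normed.contDiff_convolution_left _ η.contDiff_normed hf

/-- Mollification commutes with weak differentiation. -/
theorem fderiv_mollify (η : ContDiffBump (0 : ℝ × ℝ)) {u p : ℝ × ℝ → ℝ} {e : ℝ × ℝ}
    (hu : LocallyIntegrable u volume) (h : IsWeakDeriv e u p) (x : ℝ × ℝ) :
    fderiv ℝ (mollify η u) x e = mollify η p x := by
  have hη := η.isTestFunction_normed
  -- The weak derivative is tested against y ↦ η(x - y), whose derivative in y is minus that of η at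
  -- x - y.
  have h1 := h _ (hη.comp_const_sub x)
  have h2 : ∀ y, fderiv ℝ (fun y => η.normed volume (x - y)) y e =
      - fderiv ℝ (η.normed volume) (x - y) e := by
    intro y
    have h3 : HasFDerivAt (fun y : ℝ × ℝ => x - y) (-ContinuousLinearMap.id ℝ (ℝ × ℝ)) y :=
      (hasFDerivAt_id y).const_sub x
    have := ((hη.differentiable (x - y)).hasFDerivAt.comp y h3).fderiv
    rw [Function.comp_def] at this
    rw [this]
    simp
  simp only [h2, mul_neg, integral_neg, neg_inj] at h1
  rw [mollify_eq_integral_swap, ← h1, mollify_eq_convolution,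
    (η.hasCompactSupport_normed.hasFDerivAt_convolution_left (ContinuousLinearMap.lsmul ℝ ℝ)
      η.contDiff_normed hu x).fderiv, convolution_eq_swap]
  have hint : Integrable (fun t => (ContinuousLinearMap.precompL (ℝ × ℝ)
      (ContinuousLinearMap.lsmul ℝ ℝ)) (fderiv ℝ (η.normed volume) (x - t)) (u t)) := by
    have := (η.hasCompactSupport_normed.fderiv (𝕜 := ℝ)).convolutionExists_left
      (ContinuousLinearMap.precompL (ℝ × ℝ) (ContinuousLinearMap.lsmul ℝ ℝ (E := ℝ)))
      (hη.1.continuous_fderiv (by norm_num)) hu x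
    exact this.integrable_swap
  rw [ContinuousLinearMap.integral_apply hint]
  refine integral_congr_ae (ae_of_all _ fun y => ?_)
  simp [ContinuousLinearMap.precompL_apply, mul_comm]

/-- Mollification becomes an average over a probability measure, so Jensen's inequality applies to
it. -/
theorem isProbabilityMeasure_withDensity_normed (η : ContDiffBump (0 : ℝ × ℝ)) :
    IsProbabilityMeasure (volume.withDensity fun y => ENNReal.ofReal (η.normed volume y)) := by
  refine ⟨?_⟩
  rw [withDensity_apply _ MeasurableSet.univ, Measure.restrict_univ,
    ← ofReal_integral_eq_lintegral_ofReal η.integrable_normed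
      (ae_of_all _ fun y => η.nonneg_normed y), η.integral_normed]
  simp

theorem integral_withDensity_normed (η : ContDiffBump (0 : ℝ × ℝ)) (f : ℝ × ℝ → ℝ) :
    ∫ y, f y ∂(volume.withDensity fun y => ENNReal.ofReal (η.normed volume y)) =
      ∫ y, η.normed volume y * f y := by
  rw [integral_withDensity_eq_integral_toReal_smul₀
    (η.continuous_normed.measurable.ennreal_ofReal.aemeasurable) (by simp)]
  refine integral_congr_ae (ae_of_all _ fun y => ?_)
  simp [ENNReal.toReal_ofReal (η.nonneg_normed y)]

theorem ae_withDensity_normed (η : ContDiffBump (0 : ℝ × ℝ)) :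
    ∀ᵐ y ∂(volume.withDensity fun y => ENNReal.ofReal (η.normed volume y)), ‖y‖ ≤ η.rOut := by
  rw [ae_withDensity_iff (η.continuous_normed.measurable.ennreal_ofReal)]
  refine ae_of_all _ fun y hy => ?_
  have : y ∈ Function.support (η.normed volume) := by
    intro h0
    simp [h0] at hy
  rw [η.support_normed_eq] at this
  exact (mem_ball_zero_iff.1 this).le

theorem integrable_normed_mul_comp_sub (η : ContDiffBump (0 : ℝ × ℝ)) {f : ℝ × ℝ → ℝ}
    (hf : MemLp f 2 volume) (x : ℝ × ℝ) :
    Integrable fun y => η.normed volume y * f (x - y) := by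
  have h1 : MemLp (fun y => f (x - y)) 2 volume :=
    hf.comp_measurePreserving (Measure.measurePreserving_sub_left volume x)
  exact (η.isTestFunction_normed.memLp 2).integrable_mul_two h1

/-- The distance from `f` to its mollification is controlled by the `L²` modulus of continuity. -/
theorem lintegral_mollify_sub_le (η : ContDiffBump (0 : ℝ × ℝ)) {f : ℝ × ℝ → ℝ}
    (hf : MemLp f 2 volume) {K : ENNReal}
    (hK : ∀ y, ‖y‖ ≤ η.rOut → ∫⁻ x, ‖f (x - y) - f x‖ₑ ^ 2 ≤ K) :
    ∫⁻ x, ‖mollify η f x - f x‖ₑ ^ 2 ≤ K := by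
  have := isProbabilityMeasure_withDensity_normed η
  set ν := volume.withDensity fun y => ENNReal.ofReal (η.normed volume y) with hν
  have h1 : ∀ x, mollify η f x - f x = ∫ y, (f (x - y) - f x) ∂ν := by
    intro x
    rw [integral_withDensity_normed]
    simp only [mul_sub]
    rw [integral_sub (integrable_normed_mul_comp_sub η hf x)
      (η.integrable_normed.mul_const _), integral_mul_const, η.integral_normed, one_mul]
    rfl
  -- Since `f` is only a.e. strongly measurable, joint measurability is proved for Lebesgue measure
  -- on the product and transferred by absolute continuity.
  have hac : (volume.prod ν : Measure ((ℝ × ℝ) × (ℝ × ℝ))) ≪ volume.prod volume :=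
    Measure.AbsolutelyContinuous.rfl.prod (withDensity_absolutelyContinuous _ _)
  have hF : AEStronglyMeasurable (Function.uncurry fun x y => f (x - y) - f x)
      ((volume : Measure (ℝ × ℝ)).prod ν) := by
    refine AEStronglyMeasurable.mono_ac hac ?_
    refine AEStronglyMeasurable.sub ?_ ?_
    · exact hf.1.comp_quasiMeasurePreserving (quasiMeasurePreserving_sub volume volume)
    · exact hf.1.comp_fst
  simp only [h1]
  refine (lintegral_enorm_sq_integral_le hF).trans ?_
  calc ∫⁻ y, (∫⁻ x, ‖f (x - y) - f x‖ₑ ^ 2) ∂ν ≤ ∫⁻ _, K ∂ν := by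
        refine lintegral_mono_ae ?_
        filter_upwards [ae_withDensity_normed η] with y hy using hK y hy
    _ = K := by simp

/-- Continuity of translations in `L²`, a case of continuity of composition with measure-preserving
maps that vary continuously; `G` is that family of maps. -/
theorem tendsto_lintegral_comp_sub_sub {f : ℝ × ℝ → ℝ} (hf : MemLp f 2 volume) :
    Tendsto (fun y : ℝ × ℝ => ∫⁻ x, ‖f (x - y) - f x‖ₑ ^ 2) (𝓝 0) (𝓝 0) := by
  let G : C((ℝ × ℝ), C((ℝ × ℝ), (ℝ × ℝ))) :=
    ContinuousMap.curry ⟨fun z : (ℝ × ℝ) × (ℝ × ℝ) => z.2 - z.1, by fun_prop⟩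
  have hG : ∀ y, MeasurePreserving (G y) volume volume := fun y =>
    measurePreserving_sub_right volume y
  have h1 := Filter.Tendsto.compMeasurePreservingLp (p := 2) (l := 𝓝 (0 : ℝ × ℝ))
    (f := fun _ => hf.toLp f) tendsto_const_nhds (G.continuous.tendsto 0) hG (hG 0)
    (by norm_num)
  simp only [Lp.toLp_compMeasurePreserving] at h1
  rw [Lp.tendsto_Lp_iff_tendsto_eLpNorm'' (fun y => f ∘ G y)
    (fun y => hf.comp_measurePreserving (hG y)) (f ∘ G 0)
    (hf.comp_measurePreserving (hG 0))] at h1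
  have h2 := ((ENNReal.continuous_pow 2).tendsto 0).comp h1
  simp only [ne_eq, OfNat.ofNat_ne_zero, not_false_eq_true, zero_pow] at h2
  refine h2.congr fun y => ?_
  have h3 := eLpNorm_nnreal_pow_eq_lintegral (f := f ∘ G y - f ∘ G 0)
    (μ := (volume : Measure (ℝ × ℝ))) (p := 2) (by norm_num)
  have h4 : ∀ x, (f ∘ G y - f ∘ G 0) x = f (x - y) - f x := fun x => by simp [G]
  simpa [h4] using h3

/-- A sequence of bump functions shrinking to the origin. -/
def shrinkingBump (n : ℕ) : ContDiffBump (0 : ℝ × ℝ) where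
  rIn := 1 / (2 * ((n : ℝ) + 1))
  rOut := 1 / ((n : ℝ) + 1)
  rIn_pos := by positivity
  rIn_lt_rOut := by
    rw [one_div, one_div, mul_inv]
    have : 0 < ((n : ℝ) + 1)⁻¹ := by positivity
    linarith

theorem tendsto_shrinkingBump_rOut : Tendsto (fun n => (shrinkingBump n).rOut) atTop (𝓝 0) :=
  tendsto_one_div_add_atTop_nhds_zero_nat

/-- The crude modulus of continuity 4 ∫ f² already puts the difference between the mollification and
`f` in `L²`. -/
theorem mollify_memLp (η : ContDiffBump (0 : ℝ × ℝ)) {f : ℝ × ℝ → ℝ} (hf : MemLp f 2 volume) :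
    MemLp (mollify η f) 2 volume := by
  have hc := (contDiff_mollify η (hf.locallyIntegrable (by norm_num))).continuous
  have h1 : MemLp (fun x => mollify η f x - f x) 2 volume := by
    rw [memLp_two_iff_lintegral_enorm_sq_lt_top (f := fun x => mollify η f x - f x)
      (hc.aestronglyMeasurable.sub hf.1)]
    refine (lintegral_mollify_sub_le η hf (K := ENNReal.ofReal (4 * ∫ x, f x ^ 2))
      fun y _ => ?_).trans_lt ENNReal.ofReal_lt_top
    have hy : MeasurePreserving (fun x : ℝ × ℝ => x - y) volume volume :=
      measurePreserving_sub_right volume y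
    have hfy : MemLp (fun x => f (x - y)) 2 volume := hf.comp_measurePreserving hy
    rw [lintegral_enorm_sq_eq_ofReal (hfy.sub_two hf)]
    refine ENNReal.ofReal_le_ofReal ?_
    have := integral_sq_add_le hfy hf.neg
    simp only [Pi.neg_apply, even_two, Even.neg_pow, ← sub_eq_add_neg] at this
    rw [integral_sub_right_eq_self (fun x => f x ^ 2) y] at this
    refine this.trans (by linarith)
  have := h1.add hf
  convert this using 1
  ext x
  simp

theorem integral_mollify_sub_sq_le (η : ContDiffBump (0 : ℝ × ℝ)) {f : ℝ × ℝ → ℝ}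
    (hf : MemLp f 2 volume) {K : ℝ} (hK0 : 0 ≤ K)
    (hK : ∀ y, ‖y‖ ≤ η.rOut → ∫ x, (f (x - y) - f x) ^ 2 ≤ K) :
    ∫ x, (mollify η f x - f x) ^ 2 ≤ K := by
  rw [← ENNReal.ofReal_le_ofReal_iff hK0, ← lintegral_enorm_sq_eq_ofReal
    ((mollify_memLp η hf).sub_two hf)]
  refine lintegral_mollify_sub_le η hf fun y hy => ?_
  have hfy : MemLp (fun x => f (x - y)) 2 volume :=
    hf.comp_measurePreserving (measurePreserving_sub_right volume y)
  rw [lintegral_enorm_sq_eq_ofReal (hfy.sub_two hf)]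
  exact ENNReal.ofReal_le_ofReal (hK y hy)

/-- Mollifications converge in `L²`. -/
theorem tendsto_integral_mollify_sub_sq {f : ℝ × ℝ → ℝ} (hf : MemLp f 2 volume) :
    Tendsto (fun n => ∫ x, (mollify (shrinkingBump n) f x - f x) ^ 2) atTop (𝓝 0) := by
  rw [Metric.tendsto_atTop]
  intro ε hε
  have h1 := (tendsto_lintegral_comp_sub_sub hf).eventually_lt_const
    (ENNReal.ofReal_pos.2 (half_pos hε))
  obtain ⟨r, hr, hr'⟩ := Metric.eventually_nhds_iff.1 h1
  obtain ⟨N, hN⟩ := eventually_atTop.1 (tendsto_shrinkingBump_rOut.eventually_lt_const hr)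
  refine ⟨N, fun n hn => ?_⟩
  rw [Real.dist_eq, sub_zero, abs_of_nonneg (integral_nonneg fun x => sq_nonneg _)]
  refine (integral_mollify_sub_sq_le _ hf (half_pos hε).le fun y hy => ?_).trans_lt
    (half_lt_self hε)
  have hfy : MemLp (fun x => f (x - y)) 2 volume :=
    hf.comp_measurePreserving (measurePreserving_sub_right volume y)
  have h2 := hr' (y := y) (by rw [dist_zero_right]; exact hy.trans_lt (hN n hn))
  rw [lintegral_enorm_sq_eq_ofReal (hfy.sub_two hf)] at h2
  exact ((ENNReal.ofReal_lt_ofReal_iff (half_pos hε)).1 h2).le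

theorem mollify_eq_zero (η : ContDiffBump (0 : ℝ × ℝ)) {f : ℝ × ℝ → ℝ} {R : ℝ}
    (hf : ∀ x, R < ‖x‖ → f x = 0) {x : ℝ × ℝ} (hx : R + η.rOut < ‖x‖) : mollify η f x = 0 := by
  unfold mollify
  refine integral_eq_zero_of_ae (ae_of_all _ fun y => ?_)
  by_cases hy : ‖y‖ ≤ η.rOut
  · have : R < ‖x - y‖ := by
      have := norm_sub_norm_le x y
      linarith
    simp [hf _ this]
  · have : y ∉ Function.support (η.normed volume) := by
      rw [η.support_normed_eq, mem_ball_zero_iff]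
      exact fun h => hy h.le
    simp [Function.notMem_support.1 this]

theorem isTestFunction_mollify (η : ContDiffBump (0 : ℝ × ℝ)) {f : ℝ × ℝ → ℝ} {R : ℝ}
    (hl : LocallyIntegrable f volume) (hf : ∀ x, R < ‖x‖ → f x = 0) :
    IsTestFunction (mollify η f) :=
  ⟨contDiff_mollify η hl, HasCompactSupport.intro (isCompact_closedBall 0 (R + η.rOut))
    fun _ hx => mollify_eq_zero η hf (by simpa using hx)⟩

/-! ### Density of test functions in the form domain -/

/-- The squared form norm `∫ u² + ∫ p² + ∫ q² + ∫ (4ρ² + σ²) u²`. -/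
def formNormSq (u p q : ℝ × ℝ → ℝ) : ℝ :=
  (∫ x, u x ^ 2) + (∫ x, p x ^ 2) + (∫ x, q x ^ 2) + ∫ x, harmonicPotential x * u x ^ 2

theorem integral_sq_nonneg {α : Type*} [MeasurableSpace α] {μ : Measure α} (f : α → ℝ) :
    0 ≤ ∫ x, f x ^ 2 ∂μ :=
  integral_nonneg fun _ => sq_nonneg _

theorem integral_potential_nonneg (u : ℝ × ℝ → ℝ) : 0 ≤ ∫ x, harmonicPotential x * u x ^ 2 :=
  integral_nonneg fun x => mul_nonneg (harmonicPotential_nonneg x) (sq_nonneg _)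

theorem formNormSq_nonneg (u p q : ℝ × ℝ → ℝ) : 0 ≤ formNormSq u p q := by
  have := integral_sq_nonneg (μ := volume) u
  have := integral_sq_nonneg (μ := volume) p
  have := integral_sq_nonneg (μ := volume) q
  have := integral_potential_nonneg u
  unfold formNormSq
  linarith

theorem integral_sq_le_formNormSq (u p q : ℝ × ℝ → ℝ) : ∫ x, u x ^ 2 ≤ formNormSq u p q := by
  have := integral_sq_nonneg (μ := volume) p
  have := integral_sq_nonneg (μ := volume) q
  have := integral_potential_nonneg u
  unfold formNormSq
  linarith

theorem integral_grad_sq_le_formNormSq (u p q : ℝ × ℝ → ℝ) :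
    (∫ x, p x ^ 2) + ∫ x, q x ^ 2 ≤ formNormSq u p q := by
  have := integral_sq_nonneg (μ := volume) u
  have := integral_potential_nonneg u
  unfold formNormSq
  linarith

theorem integral_potential_le_formNormSq (u p q : ℝ × ℝ → ℝ) :
    ∫ x, harmonicPotential x * u x ^ 2 ≤ formNormSq u p q := by
  have := integral_sq_nonneg (μ := volume) u
  have := integral_sq_nonneg (μ := volume) p
  have := integral_sq_nonneg (μ := volume) q
  unfold formNormSq
  linarith

theorem FormDomain.formNormSq_add_le {u p q u' p' q' : ℝ × ℝ → ℝ} (h : FormDomain u p q)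
    (h' : FormDomain u' p' q') :
    formNormSq (fun x => u x + u' x) (fun x => p x + p' x) (fun x => q x + q' x) ≤
      2 * formNormSq u p q + 2 * formNormSq u' p' q' := by
  have h1 := integral_sq_add_le h.memLp h'.memLp
  have h2 := integral_sq_add_le h.memLp_rho h'.memLp_rho
  have h3 := integral_sq_add_le h.memLp_sigma h'.memLp_sigma
  have h4 := integral_sq_add_le h.memLp_potential h'.memLp_potential
  simp only [← mul_add, FormDomain.sqrt_potential_mul_sq] at h4
  have h5 : ∀ x, (√(harmonicPotential x) * (u x + u' x)) ^ 2 =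
      harmonicPotential x * (u x + u' x) ^ 2 := fun x =>
    FormDomain.sqrt_potential_mul_sq (fun x => u x + u' x) x
  simp only [h5] at h4
  unfold formNormSq
  linarith

/-- A sequence of smooth cutoff functions exhausting the plane. -/
theorem exists_cutoff_seq : ∃ (χ : ℕ → ℝ × ℝ → ℝ) (M : ℝ), 0 ≤ M ∧
    ∀ n, IsTestFunction (χ n) ∧ (∀ x, 0 ≤ χ n x ∧ χ n x ≤ 1) ∧
      (∀ x, ‖x‖ ≤ n + 1 → χ n x = 1) ∧
      (∀ x, |dRho (χ n) x| ≤ M / (n + 1)) ∧ ∀ x, |dSigma (χ n) x| ≤ M / (n + 1) := by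
  let b : ContDiffBump (0 : ℝ × ℝ) := ⟨1, 2, one_pos, one_lt_two⟩
  have hb : IsTestFunction b := ⟨b.contDiff, b.hasCompactSupport⟩
  obtain ⟨M₁, hM₁, h1⟩ := hb.dRho.exists_bound
  obtain ⟨M₂, hM₂, h2⟩ := hb.dSigma.exists_bound
  refine ⟨fun n x => b (((n : ℝ) + 1)⁻¹ • x), max M₁ M₂, hM₁.trans (le_max_left _ _),
    fun n => ?_⟩
  have hn : 0 < (n : ℝ) + 1 := by positivity
  have hd : ∀ x e, fderiv ℝ (fun x => b (((n : ℝ) + 1)⁻¹ • x)) x e =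
      ((n : ℝ) + 1)⁻¹ * fderiv ℝ b (((n : ℝ) + 1)⁻¹ • x) e := by
    intro x e
    rw [fderiv_comp_smul]
    simp
  refine ⟨⟨b.contDiff.comp (contDiff_id.const_smul _), ?_⟩, fun x => ⟨b.nonneg, b.le_one⟩,
    fun x hx => ?_, fun x => ?_, fun x => ?_⟩
  · exact b.hasCompactSupport.comp_homeomorph (Homeomorph.smulOfNeZero _ (inv_ne_zero hn.ne'))
  · refine b.one_of_mem_closedBall ?_
    rw [mem_closedBall_zero_iff, norm_smul, norm_inv, Real.norm_of_nonneg hn.le]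
    exact (inv_mul_le_iff₀ hn).2 (by simpa [b] using hx)
  · rw [dRho, hd, abs_mul, abs_of_pos (inv_pos.2 hn), div_eq_inv_mul]
    gcongr
    exact (h1 _).trans (le_max_left _ _)
  · rw [dSigma, hd, abs_mul, abs_of_pos (inv_pos.2 hn), div_eq_inv_mul]
    gcongr
    exact (h2 _).trans (le_max_right _ _)

theorem tendsto_integral_cutoff_sub_sq {χ : ℕ → ℝ × ℝ → ℝ} (hχ : ∀ n, IsTestFunction (χ n))
    (h01 : ∀ n x, 0 ≤ χ n x ∧ χ n x ≤ 1) (h1 : ∀ (n : ℕ) x, ‖x‖ ≤ n + 1 → χ n x = 1)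
    {f : ℝ × ℝ → ℝ} (hf : MemLp f 2 volume) :
    Tendsto (fun n => ∫ x, (f x - χ n x * f x) ^ 2) atTop (𝓝 0) := by
  have : Tendsto (fun n => ∫ x, (f x - χ n x * f x) ^ 2) atTop (𝓝 (∫ _ : ℝ × ℝ, (0 : ℝ))) := by
    refine tendsto_integral_of_dominated_convergence (fun x => f x ^ 2)
      (fun n => ((hf.1.sub ((hχ n).mul_memLp hf).1).pow 2)) hf.integrable_sq
      (fun n => ae_of_all _ fun x => ?_) (ae_of_all _ fun x => ?_)
    · have h2 : (f x - χ n x * f x) ^ 2 = (1 - χ n x) ^ 2 * f x ^ 2 := by ring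
      rw [Real.norm_of_nonneg (sq_nonneg _), h2]
      have h3 := h01 n x
      have h4 : (1 - χ n x) ^ 2 ≤ 1 := by nlinarith
      nlinarith [sq_nonneg (f x)]
    · refine tendsto_const_nhds.congr' ?_
      obtain ⟨N, hN⟩ := exists_nat_ge ‖x‖
      filter_upwards [eventually_ge_atTop N] with n hn
      have : (N : ℝ) ≤ n := by exact_mod_cast hn
      rw [h1 n x (by linarith)]
      simp
  simpa using this

theorem tendsto_integral_mul_small_sq {w : ℕ → ℝ × ℝ → ℝ} {M : ℝ}
    (hw : ∀ (n : ℕ) x, |w n x| ≤ M / (n + 1)) (hwm : ∀ n, IsTestFunction (w n))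
    {f : ℝ × ℝ → ℝ} (hf : MemLp f 2 volume) :
    Tendsto (fun n => ∫ x, (w n x * f x) ^ 2) atTop (𝓝 0) := by
  have h1 : Tendsto (fun n : ℕ => (M / ((n : ℝ) + 1)) ^ 2 * ∫ x, f x ^ 2) atTop (𝓝 0) := by
    have := ((tendsto_one_div_add_atTop_nhds_zero_nat (𝕜 := ℝ)).const_mul M).pow 2
    have := this.mul_const (∫ x, f x ^ 2)
    simpa [div_eq_mul_inv] using this
  refine squeeze_zero (fun n => integral_sq_nonneg _) (fun n => ?_) h1
  rw [← integral_const_mul]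
  refine integral_mono ((hwm n).mul_memLp hf).integrable_sq (hf.integrable_sq.const_mul _)
    fun x => ?_
  simp only [mul_pow]
  have := sq_le_sq' (abs_le.1 (hw n x)).1 (abs_le.1 (hw n x)).2
  nlinarith [sq_nonneg (f x)]

/-- Compactly supported elements are dense in the form domain. -/
theorem FormDomain.exists_cutoff {u p q : ℝ × ℝ → ℝ} (h : FormDomain u p q) {ε : ℝ} (hε : 0 < ε) :
    ∃ χ : ℝ × ℝ → ℝ, IsTestFunction χ ∧ formNormSq (fun x => u x - χ x * u x)
      (fun x => p x - (χ x * p x + dRho χ x * u x))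
      (fun x => q x - (χ x * q x + dSigma χ x * u x)) < ε := by
  obtain ⟨χ, M, -, hχ⟩ := exists_cutoff_seq
  have ht := fun n => (hχ n).1
  have hlim : ∀ {f : ℝ × ℝ → ℝ}, MemLp f 2 volume →
      Tendsto (fun n => ∫ x, (f x - χ n x * f x) ^ 2) atTop (𝓝 0) := fun hf =>
    tendsto_integral_cutoff_sub_sq ht (fun n => (hχ n).2.1) (fun n => (hχ n).2.2.1) hf
  have hgrad : ∀ {w : ℕ → ℝ × ℝ → ℝ} {f : ℝ × ℝ → ℝ}, (∀ n, IsTestFunction (w n)) →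
      (∀ (n : ℕ) x, |w n x| ≤ M / (n + 1)) → MemLp f 2 volume →
      Tendsto (fun n => ∫ x, (f x - (χ n x * f x + w n x * u x)) ^ 2) atTop (𝓝 0) := by
    intro w f hw hw' hf
    have h1 := (hlim hf).const_mul 2
    have h2 := (tendsto_integral_mul_small_sq hw' hw h.memLp).const_mul 2
    have h3 := h1.add h2
    rw [mul_zero, add_zero] at h3
    refine squeeze_zero (fun n => integral_sq_nonneg _) (fun n => ?_) h3
    have h4 := integral_sq_add_le (hf.sub_two ((ht n).mul_memLp hf)) ((hw n).mul_memLp h.memLp).neg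
    simp only [Pi.neg_apply, even_two, Even.neg_pow] at h4
    refine le_trans (le_of_eq ?_) h4
    exact integral_congr_ae (ae_of_all _ fun x => by simp only; ring)
  have h1 := hlim h.memLp
  have h2 := hgrad (fun n => (ht n).dRho) (fun n => (hχ n).2.2.2.1) h.memLp_rho
  have h3 := hgrad (fun n => (ht n).dSigma) (fun n => (hχ n).2.2.2.2) h.memLp_sigma
  have h4 : Tendsto (fun n => ∫ x, harmonicPotential x * (u x - χ n x * u x) ^ 2) atTop (𝓝 0) := by
    refine (hlim h.memLp_potential).congr fun n => integral_congr_ae (ae_of_all _ fun x => ?_)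
    simp only
    rw [← FormDomain.sqrt_potential_mul_sq (fun x => u x - χ n x * u x)]
    ring
  have h5 := ((h1.add h2).add h3).add h4
  simp only [add_zero] at h5
  obtain ⟨n, hn⟩ := (h5.eventually_lt_const hε).exists
  exact ⟨χ n, ht n, hn⟩

theorem IsTestFunction.exists_eq_zero {φ : ℝ × ℝ → ℝ} (h : IsTestFunction φ) :
    ∃ R : ℝ, 0 ≤ R ∧ ∀ x, R < ‖x‖ → φ x = 0 := by
  obtain ⟨R, hR⟩ := h.2.isCompact.isBounded.subset_closedBall 0
  refine ⟨max R 0, le_max_right _ _, fun x hx => image_eq_zero_of_notMem_tsupport fun hm => ?_⟩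
  have := mem_closedBall_zero_iff.1 (hR hm)
  exact absurd hx (not_lt.2 (this.trans (le_max_left _ _)))

theorem harmonicPotential_le_norm_sq (x : ℝ × ℝ) : harmonicPotential x ≤ 5 * ‖x‖ ^ 2 := by
  have h1 : x.1 ^ 2 ≤ ‖x‖ ^ 2 := sq_le_sq.2 (by simpa using norm_fst_le x)
  have h2 : x.2 ^ 2 ≤ ‖x‖ ^ 2 := sq_le_sq.2 (by simpa using norm_snd_le x)
  unfold harmonicPotential
  linarith

/-- Test functions approximate compactly supported elements of the form domain. -/
theorem FormDomain.exists_test_of_eq_zero {u p q : ℝ × ℝ → ℝ} (h : FormDomain u p q) {R : ℝ}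
    (hu : ∀ x, R < ‖x‖ → u x = 0) {ε : ℝ} (hε : 0 < ε) :
    ∃ φ : ℝ × ℝ → ℝ, IsTestFunction φ ∧ formNormSq (fun x => u x - φ x)
      (fun x => p x - dRho φ x) (fun x => q x - dSigma φ x) < ε := by
  have hul := h.memLp.locallyIntegrable (by norm_num)
  have hlim : ∀ {f : ℝ × ℝ → ℝ}, MemLp f 2 volume →
      Tendsto (fun n => ∫ x, (f x - mollify (shrinkingBump n) f x) ^ 2) atTop (𝓝 0) := by
    intro f hf
    refine (tendsto_integral_mollify_sub_sq hf).congr fun n =>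
      integral_congr_ae (ae_of_all _ fun x => by simp only; ring)
  have h1 := hlim h.memLp
  have h2 := hlim h.memLp_rho
  have h3 := hlim h.memLp_sigma
  have h4 : Tendsto (fun n => ∫ x, harmonicPotential x * (u x - mollify (shrinkingBump n) u x) ^ 2)
      atTop (𝓝 0) := by
    -- The bumps have radius at most 1, so every mollification vanishes beyond radius R + 1. Within
    -- it the potential is at most 5(R + 1)², and plain `L²` convergence controls the weighted term.
    have h5 := h1.const_mul (5 * (R + 1) ^ 2)
    rw [mul_zero] at h5
    refine squeeze_zero (fun n => integral_potential_nonneg _) (fun n => ?_) h5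
    rw [← integral_const_mul]
    have hm := (h.sub (isTestFunction_mollify (shrinkingBump n) hul hu).formDomain)
    refine integral_mono hm.integrable_potential (hm.memLp.integrable_sq.const_mul _) fun x => ?_
    simp only
    have hr : (shrinkingBump n).rOut ≤ 1 := by
      simp only [shrinkingBump]
      exact div_le_one_of_le₀ (by linarith [(Nat.cast_nonneg n : (0 : ℝ) ≤ n)]) (by positivity)
    by_cases hx : R + 1 < ‖x‖
    · rw [hu x (by linarith), mollify_eq_zero _ hu (by linarith)]
      simp
    · refine mul_le_mul_of_nonneg_right ((harmonicPotential_le_norm_sq x).trans ?_) (sq_nonneg _)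
      have := norm_nonneg x
      gcongr
      linarith
  have h5 := ((h1.add h2).add h3).add h4
  simp only [add_zero] at h5
  obtain ⟨n, hn⟩ := (h5.eventually_lt_const hε).exists
  refine ⟨_, isTestFunction_mollify (shrinkingBump n) hul hu, ?_⟩
  have h6 : dRho (mollify (shrinkingBump n) u) = mollify (shrinkingBump n) p :=
    funext fun x => fderiv_mollify _ hul h.weakDeriv_rho x
  have h7 : dSigma (mollify (shrinkingBump n) u) = mollify (shrinkingBump n) q :=
    funext fun x => fderiv_mollify _ hul h.weakDeriv_sigma x
  rw [h6, h7]
  exact hn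

/-- Test functions are dense in the form domain. -/
theorem FormDomain.exists_test {u p q : ℝ × ℝ → ℝ} (h : FormDomain u p q) {ε : ℝ} (hε : 0 < ε) :
    ∃ φ : ℝ × ℝ → ℝ, IsTestFunction φ ∧ formNormSq (fun x => u x - φ x)
      (fun x => p x - dRho φ x) (fun x => q x - dSigma φ x) < ε := by
  -- The squared form norm of a sum costs a factor 2 on each of the two errors, hence ε/4.
  obtain ⟨χ, hχ, h1⟩ := h.exists_cutoff (show 0 < ε / 4 by positivity)
  obtain ⟨R, -, hR'⟩ := hχ.exists_eq_zero
  obtain ⟨φ, hφ, h2⟩ := (h.test_mul hχ).exists_test_of_eq_zero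
    (fun x hx => by rw [hR' x hx, zero_mul]) (show 0 < ε / 4 by positivity)
  refine ⟨φ, hφ, ?_⟩
  have h3 := (h.sub (h.test_mul hχ)).formNormSq_add_le ((h.test_mul hχ).sub hφ.formDomain)
  simp only [sub_add_sub_cancel] at h3
  linarith

theorem FormDomain.exists_test_seq {u p q : ℝ × ℝ → ℝ} (h : FormDomain u p q) :
    ∃ φ : ℕ → ℝ × ℝ → ℝ, (∀ n, IsTestFunction (φ n)) ∧
      Tendsto (fun n => formNormSq (fun x => φ n x - u x)
        (fun x => dRho (φ n) x - p x) (fun x => dSigma (φ n) x - q x)) atTop (𝓝 0) := by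
  choose φ hφ hφ' using fun n : ℕ => h.exists_test (show 0 < 1 / ((n : ℝ) + 1) by positivity)
  refine ⟨φ, hφ, squeeze_zero (fun n => formNormSq_nonneg _ _ _) (fun n => ?_)
    tendsto_one_div_add_atTop_nhds_zero_nat⟩
  refine le_trans (le_of_eq ?_) (hφ' n).le
  unfold formNormSq
  simp only [fun (a b : ℝ) => show (a - b) ^ 2 = (b - a) ^ 2 by ring]

theorem FormDomain.exists_test_seq_tendsto {u p q : ℝ × ℝ → ℝ} (h : FormDomain u p q) :
    ∃ φ : ℕ → ℝ × ℝ → ℝ, (∀ n, IsTestFunction (φ n)) ∧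
      Tendsto (fun n => ∫ x, (φ n x - u x) ^ 2) atTop (𝓝 0) ∧
      Tendsto (fun n => ∫ x, (dRho (φ n) x - p x) ^ 2) atTop (𝓝 0) ∧
      Tendsto (fun n => ∫ x, (dSigma (φ n) x - q x) ^ 2) atTop (𝓝 0) ∧
      Tendsto (fun n => ∫ x, harmonicPotential x * (φ n x - u x) ^ 2) atTop (𝓝 0) := by
  obtain ⟨φ, hφ, hlim⟩ := h.exists_test_seq
  refine ⟨φ, hφ, squeeze_zero (fun n => integral_sq_nonneg _)
    (fun n => integral_sq_le_formNormSq _ _ _) hlim,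
    squeeze_zero (fun n => integral_sq_nonneg _) (fun n => ?_) hlim,
    squeeze_zero (fun n => integral_sq_nonneg _) (fun n => ?_) hlim,
    squeeze_zero (fun n => integral_potential_nonneg _)
    (fun n => integral_potential_le_formNormSq _ _ _) hlim⟩
  · exact (le_add_of_nonneg_right (integral_sq_nonneg _)).trans
      (integral_grad_sq_le_formNormSq _ _ _)
  · exact (le_add_of_nonneg_left (integral_sq_nonneg _)).trans
      (integral_grad_sq_le_formNormSq _ _ _)

/-! ### Ladyzhenskaya's inequality -/

theorem fderiv_apply_eq_dRho_dSigma (φ : ℝ × ℝ → ℝ) (x y : ℝ × ℝ) :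
    fderiv ℝ φ x y = y.1 * dRho φ x + y.2 * dSigma φ x := by
  have : y = y.1 • (1, 0) + y.2 • ((0, 1) : ℝ × ℝ) := by ext <;> simp
  conv_lhs => rw [this]
  rw [map_add, map_smul, map_smul]
  rfl

theorem abs_fderiv_apply_le (φ : ℝ × ℝ → ℝ) (x y : ℝ × ℝ) :
    |fderiv ℝ φ x y| ≤ (|dRho φ x| + |dSigma φ x|) * ‖y‖ := by
  rw [fderiv_apply_eq_dRho_dSigma]
  refine (abs_add_le _ _).trans ?_
  rw [abs_mul, abs_mul, add_mul, mul_comm, mul_comm |y.2|]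
  have h1 : |y.1| ≤ ‖y‖ := norm_fst_le y
  have h2 : |y.2| ≤ ‖y‖ := norm_snd_le y
  gcongr

theorem norm_fderiv_le (φ : ℝ × ℝ → ℝ) (x : ℝ × ℝ) :
    ‖fderiv ℝ φ x‖ ≤ |dRho φ x| + |dSigma φ x| :=
  ContinuousLinearMap.opNorm_le_bound _ (by positivity) fun y => abs_fderiv_apply_le φ x y

/-- Ladyzhenskaya's inequality for test functions. -/
theorem exists_integral_pow_four_test_le : ∃ K : ℝ, 0 ≤ K ∧ ∀ φ : ℝ × ℝ → ℝ, IsTestFunction φ →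
    ∫ x, φ x ^ 4 ≤ K * (∫ x, φ x ^ 2) * ((∫ x, dRho φ x ^ 2) + ∫ x, dSigma φ x ^ 2) := by
  let C := lintegralPowLePowLIntegralFDerivConst (volume : Measure (ℝ × ℝ)) 2
  refine ⟨8 * C, by positivity, fun φ hφ => ?_⟩
  -- The Sobolev inequality from W^{1,1} to L² in the plane is applied to φ². As ∇(φ²) = 2φ∇φ,
  -- Cauchy-Schwarz bounds its `L¹` norm, and squaring 2√A(√P + √Q) produces the 8.
  have hu : IsTestFunction (fun x => φ x * φ x) := hφ.smooth_mul hφ.1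
  have hfin : Module.finrank ℝ (ℝ × ℝ) = 2 := by simp
  have h1 := lintegral_pow_le_pow_lintegral_fderiv (μ := (volume : Measure (ℝ × ℝ)))
    (u := fun x => φ x * φ x) (p := 2) (hu.1.of_le (by norm_num)) hu.2
    (by rw [hfin]; exact_mod_cast Real.HolderConjugate.two_two)
  set A := ∫ x, φ x ^ 2
  set P := ∫ x, dRho φ x ^ 2
  set Q := ∫ x, dSigma φ x ^ 2
  have hA : 0 ≤ A := integral_sq_nonneg _
  have hP : 0 ≤ P := integral_sq_nonneg _
  have hQ : 0 ≤ Q := integral_sq_nonneg _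
  have hr : Integrable fun x => |φ x| * |dRho φ x| :=
    (hφ.memLp 2).abs.integrable_mul_two (hφ.dRho.memLp 2).abs
  have hs : Integrable fun x => |φ x| * |dSigma φ x| :=
    (hφ.memLp 2).abs.integrable_mul_two (hφ.dSigma.memLp 2).abs
  have h2 : ∫⁻ x, ‖fderiv ℝ (fun x => φ x * φ x) x‖ₑ ≤ ENNReal.ofReal (2 * √A * (√P + √Q)) := by
    have h3 : ∀ x, ‖fderiv ℝ (fun x => φ x * φ x) x‖ ≤
        2 * (|φ x| * |dRho φ x| + |φ x| * |dSigma φ x|) := by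
      intro x
      rw [fderiv_fun_mul (hφ.differentiable x) (hφ.differentiable x), ← two_smul ℝ, norm_smul,
        norm_smul, ← mul_add, Real.norm_two, Real.norm_eq_abs]
      have := norm_fderiv_le φ x
      gcongr
    calc ∫⁻ x, ‖fderiv ℝ (fun x => φ x * φ x) x‖ₑ
        ≤ ∫⁻ x, ENNReal.ofReal (2 * (|φ x| * |dRho φ x| + |φ x| * |dSigma φ x|)) := by
          refine lintegral_mono fun x => ?_
          rw [← ofReal_norm]
          exact ENNReal.ofReal_le_ofReal (h3 x)
      _ = ENNReal.ofReal (∫ x, 2 * (|φ x| * |dRho φ x| + |φ x| * |dSigma φ x|)) :=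
          (ofReal_integral_eq_lintegral_ofReal ((hr.add hs).const_mul 2)
            (ae_of_all _ fun x => mul_nonneg zero_le_two (add_nonneg
              (mul_nonneg (abs_nonneg _) (abs_nonneg _))
              (mul_nonneg (abs_nonneg _) (abs_nonneg _))))).symm
      _ ≤ ENNReal.ofReal (2 * √A * (√P + √Q)) := by
          refine ENNReal.ofReal_le_ofReal ?_
          rw [integral_const_mul, integral_add hr hs]
          have h4 := (le_abs_self _).trans
            (abs_integral_mul_le (hφ.memLp 2).abs (hφ.dRho.memLp 2).abs)
          have h5 := (le_abs_self _).trans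
            (abs_integral_mul_le (hφ.memLp 2).abs (hφ.dSigma.memLp 2).abs)
          simp only [sq_abs, Pi.abs_apply] at h4 h5
          linarith
  have h6 : ∫⁻ x, ‖φ x * φ x‖ₑ ^ (2 : ℝ) = ENNReal.ofReal (∫ x, φ x ^ 4) := by
    have := lintegral_enorm_sq_eq_ofReal (hu.memLp 2)
    simp only [ENNReal.rpow_ofNat, this]
    congr 2
    ext x
    ring
  rw [h6] at h1
  have h7 : ENNReal.ofReal (∫ x, φ x ^ 4) ≤ ENNReal.ofReal (C * (2 * √A * (√P + √Q)) ^ 2) := by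
    refine h1.trans ?_
    rw [ENNReal.ofReal_mul (by positivity), ENNReal.ofReal_coe_nnreal,
      ENNReal.ofReal_pow (by positivity), ENNReal.rpow_ofNat]
    gcongr
  have h8 := (ENNReal.ofReal_le_ofReal_iff (by positivity)).1 h7
  refine h8.trans ?_
  have h9 : (2 * √A * (√P + √Q)) ^ 2 ≤ 8 * A * (P + Q) := by
    have e1 := Real.sq_sqrt hA
    have e2 := Real.sq_sqrt hP
    have e3 := Real.sq_sqrt hQ
    have e4 : (√P + √Q) ^ 2 ≤ 2 * (P + Q) := by nlinarith [sq_nonneg (√P - √Q)]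
    calc (2 * √A * (√P + √Q)) ^ 2 = 4 * A * (√P + √Q) ^ 2 := by
          rw [mul_pow, mul_pow, e1]; norm_num
      _ ≤ 4 * A * (2 * (P + Q)) := by gcongr
      _ = _ := by ring
  calc (C : ℝ) * (2 * √A * (√P + √Q)) ^ 2 ≤ C * (8 * A * (P + Q)) := by gcongr
    _ = _ := by ring

/-- Ladyzhenskaya's inequality on the form domain. -/
theorem exists_integral_pow_four_le : ∃ K : ℝ, 0 ≤ K ∧ ∀ u p q : ℝ × ℝ → ℝ, FormDomain u p q →
    MemLp (fun x => u x ^ 2) 2 volume ∧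
      ∫ x, u x ^ 4 ≤ K * (∫ x, u x ^ 2) * ((∫ x, p x ^ 2) + ∫ x, q x ^ 2) := by
  obtain ⟨K, hK, hle⟩ := exists_integral_pow_four_test_le
  refine ⟨K, hK, fun u p q h => ?_⟩
  obtain ⟨φ, hφ, h1, h2, h3, -⟩ := h.exists_test_seq_tendsto
  obtain ⟨ns, hns, hae⟩ := exists_subseq_tendsto_ae_of_tendsto
    (fun n => (hφ n).memLp 2) h.memLp h1
  have l1 := tendsto_integral_sq_of_tendsto (fun n => (hφ n).memLp 2) h.memLp h1
  have l2 := tendsto_integral_sq_of_tendsto (fun n => (hφ n).dRho.memLp 2) h.memLp_rho h2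
  have l3 := tendsto_integral_sq_of_tendsto (fun n => (hφ n).dSigma.memLp 2) h.memLp_sigma h3
  have l4 := ENNReal.tendsto_ofReal
    (((l1.const_mul K).mul (l2.add l3)).comp hns.tendsto_atTop)
  have hsq : ∀ n, MemLp (fun x => φ n x ^ 2) 2 volume := fun n => by
    simpa only [sq] using ((hφ n).smooth_mul (hφ n).1).memLp 2
  -- Fatou's lemma along an a.e. convergent subsequence of test functions; the right-hand sides
  -- converge because the approximation is in the form norm.
  have hF : ∫⁻ x, ‖u x ^ 2‖ₑ ^ 2 ≤
      ENNReal.ofReal (K * (∫ x, u x ^ 2) * ((∫ x, p x ^ 2) + ∫ x, q x ^ 2)) := by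
    calc ∫⁻ x, ‖u x ^ 2‖ₑ ^ 2 = ∫⁻ x, liminf (fun n => ‖φ (ns n) x ^ 2‖ₑ ^ 2) atTop := by
          refine lintegral_congr_ae ?_
          filter_upwards [hae] with x hx
          exact (((ENNReal.continuous_pow 2).tendsto _).comp (hx.pow 2).enorm).liminf_eq.symm
      _ ≤ liminf (fun n => ∫⁻ x, ‖φ (ns n) x ^ 2‖ₑ ^ 2) atTop :=
          lintegral_liminf_le' fun n => ((hsq (ns n)).1.enorm.pow_const 2)
      _ ≤ liminf (fun n => ENNReal.ofReal (K * (∫ x, φ (ns n) x ^ 2) *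
            ((∫ x, dRho (φ (ns n)) x ^ 2) + ∫ x, dSigma (φ (ns n)) x ^ 2))) atTop := by
          refine liminf_le_liminf (Eventually.of_forall fun n => ?_)
          rw [lintegral_enorm_sq_eq_ofReal (hsq (ns n))]
          refine ENNReal.ofReal_le_ofReal ?_
          simp only [← pow_mul]
          exact hle _ (hφ (ns n))
      _ = _ := l4.liminf_eq
  have hm : MemLp (fun x => u x ^ 2) 2 volume :=
    (memLp_two_iff_lintegral_enorm_sq_lt_top (h.memLp.1.pow 2)).2
      (hF.trans_lt ENNReal.ofReal_lt_top)
  refine ⟨hm, ?_⟩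
  rw [lintegral_enorm_sq_eq_ofReal hm] at hF
  simp only [← pow_mul] at hF
  refine (ENNReal.ofReal_le_ofReal_iff ?_).1 hF
  exact mul_nonneg (mul_nonneg hK (integral_sq_nonneg _))
    (add_nonneg (integral_sq_nonneg _) (integral_sq_nonneg _))

/-! ### Compactness of the form domain in `L²` -/

/-- Translations are Lipschitz in `L²` on test functions. -/
theorem IsTestFunction.integral_comp_sub_sub_sq_le {φ : ℝ × ℝ → ℝ} (hφ : IsTestFunction φ)
    (y : ℝ × ℝ) : ∫ x, (φ (x - y) - φ x) ^ 2 ≤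
      2 * ‖y‖ ^ 2 * ((∫ x, _root_.dRho φ x ^ 2) + ∫ x, _root_.dSigma φ x ^ 2) := by
  have hφy : MemLp (fun x => φ (x - y)) 2 volume :=
    (hφ.memLp 2).comp_measurePreserving (measurePreserving_sub_right volume y)
  -- The increment is the mean over t in (0, 1] of a directional derivative at x - ty. Jensen moves
  -- the square inside, and translation invariance removes the dependence on t.
  have : IsProbabilityMeasure (volume.restrict (Set.Ioc (0 : ℝ) 1)) := ⟨by simp⟩
  have hc : Continuous fun z : (ℝ × ℝ) × ℝ => fderiv ℝ φ (z.1 - z.2 • y) (-y) :=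
    ((hφ.1.continuous_fderiv (by norm_num)).comp
      (continuous_fst.sub (continuous_snd.smul continuous_const))).clm_apply continuous_const
  have h1 : ∀ x, φ (x - y) - φ x =
      ∫ t, fderiv ℝ φ (x - t • y) (-y) ∂(volume.restrict (Set.Ioc (0 : ℝ) 1)) := by
    intro x
    rw [← intervalIntegral.integral_of_le zero_le_one,
      intervalIntegral.integral_eq_sub_of_hasDerivAt (f := fun t : ℝ => φ (x - t • y))]
    · simp
    · intro t _
      have h2 : HasDerivAt (fun t : ℝ => x - t • y) (-y) t := by
        simpa using ((hasDerivAt_id t).smul_const y).const_sub x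
      exact (hφ.differentiable (x - t • y)).hasFDerivAt.comp_hasDerivAt t h2
    · exact (hc.comp (Continuous.prodMk_right x)).intervalIntegrable _ _
  have h3 := lintegral_enorm_sq_integral_le (μ := (volume : Measure (ℝ × ℝ)))
    (ν := volume.restrict (Set.Ioc (0 : ℝ) 1))
    (F := fun x t => fderiv ℝ φ (x - t • y) (-y)) hc.aestronglyMeasurable
  simp only [← h1] at h3
  have hd : MemLp (fun x => fderiv ℝ φ x (-y)) 2 volume := (hφ.fderiv_apply (-y)).memLp 2
  have h4 : ∀ t : ℝ, ∫⁻ x, ‖fderiv ℝ φ (x - t • y) (-y)‖ₑ ^ 2 =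
      ENNReal.ofReal (∫ x, fderiv ℝ φ x (-y) ^ 2) := fun t => by
    rw [lintegral_sub_right_eq_self (fun x => ‖fderiv ℝ φ x (-y)‖ₑ ^ 2) (t • y),
      lintegral_enorm_sq_eq_ofReal hd]
  simp only [h4, lintegral_const, measure_univ, mul_one] at h3
  rw [lintegral_enorm_sq_eq_ofReal (hφy.sub_two (hφ.memLp 2)),
    ENNReal.ofReal_le_ofReal_iff (integral_sq_nonneg _)] at h3
  refine h3.trans ?_
  rw [← integral_add (hφ.dRho.memLp 2).integrable_sq (hφ.dSigma.memLp 2).integrable_sq,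
    ← integral_const_mul]
  refine integral_mono hd.integrable_sq (((hφ.dRho.memLp 2).integrable_sq.add
    (hφ.dSigma.memLp 2).integrable_sq).const_mul _) fun x => ?_
  simp only
  have h5 := abs_fderiv_apply_le φ x (-y)
  rw [norm_neg] at h5
  have h6 := sq_le_sq' (abs_le.1 h5).1 (abs_le.1 h5).2
  refine h6.trans ?_
  rw [mul_pow]
  have h7 : (|_root_.dRho φ x| + |_root_.dSigma φ x|) ^ 2 ≤ 2 * (_root_.dRho φ x ^ 2 + _root_.dSigma φ x ^ 2) := by
    rw [← sq_abs (_root_.dRho φ x), ← sq_abs (_root_.dSigma φ x)]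
    nlinarith [sq_nonneg (|_root_.dRho φ x| - |_root_.dSigma φ x|)]
  nlinarith [sq_nonneg ‖y‖]

theorem integral_comp_sub_sq (f : ℝ × ℝ → ℝ) (y : ℝ × ℝ) :
    ∫ x, f (x - y) ^ 2 = ∫ x, f x ^ 2 :=
  integral_sub_right_eq_self (fun x => f x ^ 2) y

theorem MeasureTheory.MemLp.comp_sub_right {f : ℝ × ℝ → ℝ} (hf : MemLp f 2 volume) (y : ℝ × ℝ) :
    MemLp (fun x => f (x - y)) 2 volume :=
  hf.comp_measurePreserving (measurePreserving_sub_right volume y)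

/-- Translations are Lipschitz in `L²` on the form domain. -/
theorem FormDomain.integral_comp_sub_sub_sq_le {u p q : ℝ × ℝ → ℝ} (h : FormDomain u p q)
    (y : ℝ × ℝ) : ∫ x, (u (x - y) - u x) ^ 2 ≤
      2 * ‖y‖ ^ 2 * ((∫ x, p x ^ 2) + ∫ x, q x ^ 2) := by
  obtain ⟨φ, hφ, h1, h2, h3, -⟩ := h.exists_test_seq_tendsto
  have l2 := tendsto_integral_sq_of_tendsto (fun n => (hφ n).dRho.memLp 2) h.memLp_rho h2
  have l3 := tendsto_integral_sq_of_tendsto (fun n => (hφ n).dSigma.memLp 2) h.memLp_sigma h3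
  have hm := fun n => (hφ n).memLp 2
  have l1 : Tendsto (fun n => ∫ x, (φ n (x - y) - φ n x) ^ 2) atTop
      (𝓝 (∫ x, (u (x - y) - u x) ^ 2)) := by
    refine tendsto_integral_sq_of_tendsto (fun n => ((hm n).comp_sub_right y).sub_two (hm n))
      ((h.memLp.comp_sub_right y).sub_two h.memLp) ?_
    have l4 := h1.const_mul 4
    rw [mul_zero] at l4
    refine squeeze_zero (fun n => integral_sq_nonneg _) (fun n => ?_) l4
    have hd := (hm n).sub_two h.memLp
    have h5 := integral_sq_add_le (hd.comp_sub_right y) hd.neg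
    simp only [Pi.neg_apply, even_two, Even.neg_pow] at h5
    rw [integral_comp_sub_sq (fun x => φ n x - u x) y] at h5
    refine le_trans (le_of_eq ?_) (h5.trans (by linarith))
    exact integral_congr_ae (ae_of_all _ fun x => by simp only; ring)
  exact le_of_tendsto_of_tendsto' l1 ((l2.add l3).const_mul _) fun n =>
    (hφ n).integral_comp_sub_sub_sq_le y

theorem FormDomain.integral_mollify_sub_sq_le {u p q : ℝ × ℝ → ℝ} (h : FormDomain u p q)
    (η : ContDiffBump (0 : ℝ × ℝ)) : ∫ x, (mollify η u x - u x) ^ 2 ≤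
      2 * η.rOut ^ 2 * ((∫ x, p x ^ 2) + ∫ x, q x ^ 2) := by
  have h0 : 0 ≤ (∫ x, p x ^ 2) + ∫ x, q x ^ 2 :=
    add_nonneg (integral_sq_nonneg _) (integral_sq_nonneg _)
  refine _root_.integral_mollify_sub_sq_le η h.memLp (by positivity) fun y hy => ?_
  refine (h.integral_comp_sub_sub_sq_le y).trans ?_
  gcongr

/-- The quadratic form `∫ |∇u|² + (4ρ² + σ²) u²` of the harmonic oscillator. -/
def formEnergy (u p q : ℝ × ℝ → ℝ) : ℝ :=
  (∫ x, p x ^ 2) + (∫ x, q x ^ 2) + ∫ x, harmonicPotential x * u x ^ 2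

theorem formNormSq_eq (u p q : ℝ × ℝ → ℝ) :
    formNormSq u p q = (∫ x, u x ^ 2) + formEnergy u p q := by
  unfold formNormSq formEnergy
  ring

theorem formEnergy_nonneg (u p q : ℝ × ℝ → ℝ) : 0 ≤ formEnergy u p q :=
  add_nonneg (add_nonneg (integral_sq_nonneg _) (integral_sq_nonneg _))
    (integral_potential_nonneg _)

theorem integral_grad_sq_le_formEnergy (u p q : ℝ × ℝ → ℝ) :
    (∫ x, p x ^ 2) + ∫ x, q x ^ 2 ≤ formEnergy u p q :=
  le_add_of_nonneg_right (integral_potential_nonneg _)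

/-- The norm of `ℝ × ℝ` is the maximum norm, which the Euclidean radius dominates. -/
theorem norm_sq_le_harmonicPotential (x : ℝ × ℝ) : ‖x‖ ^ 2 ≤ harmonicPotential x := by
  refine le_trans ?_ (radius_sq_le_harmonicPotential x)
  rw [Prod.norm_def]
  rcases max_choice ‖x.1‖ ‖x.2‖ with h | h <;> rw [h, Real.norm_eq_abs, sq_abs]
  · nlinarith [sq_nonneg x.2]
  · nlinarith [sq_nonneg x.1]

/-- Rellich-type estimate: in the form domain the `L²` norm is controlled by the mollification on
a ball, up to a small multiple of the form norm. -/
theorem FormDomain.integral_sq_le_mollify {u p q : ℝ × ℝ → ℝ} (h : FormDomain u p q)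
    (η : ContDiffBump (0 : ℝ × ℝ)) {R : ℝ} (hR : 0 < R) :
    ∫ x, u x ^ 2 ≤ (4 * η.rOut ^ 2 + 1 / R ^ 2) * formNormSq u p q +
      2 * ∫ x in Metric.closedBall 0 R, mollify η u x ^ 2 := by
  have hm := mollify_memLp η h.memLp
  have h1 := h.integral_mollify_sub_sq_le η
  have h2 := integral_grad_sq_le_formNormSq u p q
  have h3 := integral_potential_le_formNormSq u p q
  have hB : MeasurableSet (Metric.closedBall (0 : ℝ × ℝ) R) := measurableSet_closedBall
  have i1 := (hm.sub_two h.memLp).integrable_sq.const_mul 2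
  have i2 := h.integrable_potential.const_mul (1 / R ^ 2)
  have i12 : Integrable fun x => 2 * (mollify η u x - u x) ^ 2 +
      1 / R ^ 2 * (harmonicPotential x * u x ^ 2) := i1.add i2
  have i3 := (hm.integrable_sq.indicator hB).const_mul 2
  -- Inside the ball u is split as its mollification plus an error. Outside, the potential is at
  -- least R², so u² is at most R⁻² times the potential energy density.
  have h4 : ∫ x, u x ^ 2 ≤ ∫ x, (2 * (mollify η u x - u x) ^ 2 +
      1 / R ^ 2 * (harmonicPotential x * u x ^ 2) +
      2 * (Metric.closedBall 0 R).indicator (fun x => mollify η u x ^ 2) x) := by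
    refine integral_mono h.memLp.integrable_sq (i12.add i3) fun x => ?_
    simp only
    have hV : 0 ≤ 1 / R ^ 2 * (harmonicPotential x * u x ^ 2) :=
      mul_nonneg (by positivity) (mul_nonneg (harmonicPotential_nonneg x) (sq_nonneg _))
    by_cases hx : x ∈ Metric.closedBall 0 R
    · rw [Set.indicator_of_mem hx]
      nlinarith [sq_nonneg (2 * mollify η u x - u x)]
    · rw [Set.indicator_of_notMem hx]
      have hx' : R < ‖x‖ := by simpa using hx
      have h5 : R ^ 2 ≤ harmonicPotential x :=
        (by gcongr : R ^ 2 ≤ ‖x‖ ^ 2).trans (norm_sq_le_harmonicPotential x)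
      have h6 : u x ^ 2 ≤ 1 / R ^ 2 * (harmonicPotential x * u x ^ 2) := by
        rw [one_div, le_inv_mul_iff₀ (by positivity)]
        gcongr
      nlinarith [sq_nonneg (mollify η u x - u x)]
  rw [integral_add i12 i3, integral_add i1 i2, integral_const_mul, integral_const_mul,
    integral_const_mul, integral_indicator hB] at h4
  have h7 : 1 / R ^ 2 * ∫ x, harmonicPotential x * u x ^ 2 ≤ 1 / R ^ 2 * formNormSq u p q := by
    gcongr
  have h8 : 2 * η.rOut ^ 2 * ((∫ x, p x ^ 2) + ∫ x, q x ^ 2) ≤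
      2 * η.rOut ^ 2 * formNormSq u p q := by gcongr
  linarith

/-- At each point the mollification is the pairing of `w n` with a fixed `L²` function, so it tends
to 0. Cauchy-Schwarz bounds it uniformly, and dominated convergence applies on the ball. -/
theorem tendsto_setIntegral_mollify_sq {w : ℕ → ℝ × ℝ → ℝ} (hw : ∀ n, MemLp (w n) 2 volume)
    {C : ℝ} (hC : ∀ n, ∫ x, w n x ^ 2 ≤ C)
    (hweak : ∀ h : ℝ × ℝ → ℝ, MemLp h 2 volume → Tendsto (fun n => ∫ x, w n x * h x) atTop (𝓝 0))
    (η : ContDiffBump (0 : ℝ × ℝ)) (R : ℝ) :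
    Tendsto (fun n => ∫ x in Metric.closedBall 0 R, mollify η (w n) x ^ 2) atTop (𝓝 0) := by
  have hη := η.isTestFunction_normed
  have hηx : ∀ x, ∫ y, η.normed volume (x - y) ^ 2 = ∫ y, η.normed volume y ^ 2 := fun x =>
    integral_sub_left_eq_self (fun y => η.normed volume y ^ 2) volume x
  have : Tendsto (fun n => ∫ x in Metric.closedBall 0 R, mollify η (w n) x ^ 2) atTop
      (𝓝 (∫ _ in Metric.closedBall (0 : ℝ × ℝ) R, (0 : ℝ))) := by
    refine tendsto_integral_of_dominated_convergence
      (fun _ => C * ∫ y, η.normed volume y ^ 2)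
      (fun n => (mollify_memLp η (hw n)).1.restrict.pow 2) ?_
      (fun n => ae_of_all _ fun x => ?_) (ae_of_all _ fun x => ?_)
    · exact integrableOn_const (isCompact_closedBall _ _).measure_lt_top.ne
    · rw [Real.norm_of_nonneg (sq_nonneg _), mollify_eq_integral_swap]
      refine (sq_integral_mul_le (hw n) ((hη.comp_const_sub x).memLp 2)).trans ?_
      rw [hηx]
      exact mul_le_mul_of_nonneg_right (hC n) (integral_sq_nonneg _)
    · simp only [mollify_eq_integral_swap]
      simpa using (hweak _ ((hη.comp_const_sub x).memLp 2)).pow 2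
  simpa using this

/-- A weakly null sequence that is bounded in the form norm is strongly null in `L²`. -/
theorem tendsto_integral_sq_of_weakly_tendsto_zero {w p q : ℕ → ℝ × ℝ → ℝ}
    (hw : ∀ n, FormDomain (w n) (p n) (q n)) {C : ℝ}
    (hC : ∀ n, formNormSq (w n) (p n) (q n) ≤ C)
    (hweak : ∀ h : ℝ × ℝ → ℝ, MemLp h 2 volume →
      Tendsto (fun n => ∫ x, w n x * h x) atTop (𝓝 0)) :
    Tendsto (fun n => ∫ x, w n x ^ 2) atTop (𝓝 0) := by
  have hC0 : 0 ≤ C := (formNormSq_nonneg _ _ _).trans (hC 0)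
  rw [Metric.tendsto_atTop]
  intro ε hε
  have hr : Tendsto (fun k : ℕ => (4 * (shrinkingBump k).rOut ^ 2 + 1 / ((k : ℝ) + 1) ^ 2) * C)
      atTop (𝓝 0) := by
    have h1 := (tendsto_shrinkingBump_rOut.pow 2).const_mul 4
    have h2 := (tendsto_one_div_add_atTop_nhds_zero_nat (𝕜 := ℝ)).pow 2
    have h3 := (h1.add h2).mul_const C
    simpa [div_pow] using h3
  obtain ⟨k, hk⟩ := (hr.eventually_lt_const (half_pos hε)).exists
  have h4 := tendsto_setIntegral_mollify_sq (fun n => (hw n).memLp)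
    (fun n => (integral_sq_le_formNormSq _ _ _).trans (hC n)) hweak (shrinkingBump k) ((k : ℝ) + 1)
  obtain ⟨N, hN⟩ := eventually_atTop.1 (h4.eventually_lt_const (show 0 < ε / 4 by positivity))
  refine ⟨N, fun n hn => ?_⟩
  rw [Real.dist_eq, sub_zero, abs_of_nonneg (integral_sq_nonneg _)]
  have h5 := (hw n).integral_sq_le_mollify (shrinkingBump k) (show 0 < (k : ℝ) + 1 by positivity)
  have h6 := hN n hn
  have h7 : (4 * (shrinkingBump k).rOut ^ 2 + 1 / ((k : ℝ) + 1) ^ 2) *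
      formNormSq (w n) (p n) (q n) ≤
      (4 * (shrinkingBump k).rOut ^ 2 + 1 / ((k : ℝ) + 1) ^ 2) * C := by
    gcongr
    exact hC n
  linarith

theorem IsWeakDeriv.of_weakly_tendsto {e : ℝ × ℝ} {u p : ℕ → ℝ × ℝ → ℝ} {u₀ p₀ : ℝ × ℝ → ℝ}
    (h : ∀ n, IsWeakDeriv e (u n) (p n))
    (hu : ∀ h : ℝ × ℝ → ℝ, MemLp h 2 volume →
      Tendsto (fun n => ∫ x, u n x * h x) atTop (𝓝 (∫ x, u₀ x * h x)))
    (hp : ∀ h : ℝ × ℝ → ℝ, MemLp h 2 volume →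
      Tendsto (fun n => ∫ x, p n x * h x) atTop (𝓝 (∫ x, p₀ x * h x))) :
    IsWeakDeriv e u₀ p₀ := by
  intro φ hφ
  refine tendsto_nhds_unique (hu _ ((hφ.fderiv_apply e).memLp 2)) ?_
  simp only [fun n => h n φ hφ]
  exact (hp _ (hφ.memLp 2)).neg

/-- Multiplication by the unbounded weight is not weakly continuous on `L²`. The limit is identified
by testing with compactly supported φ, for which the weight times φ is still in `L²`. -/
theorem eq_sqrt_potential_mul_of_weakly_tendsto {u : ℕ → ℝ × ℝ → ℝ} {u₀ z : ℝ × ℝ → ℝ}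
    (hu₀ : MemLp u₀ 2 volume) (hz₀ : MemLp z 2 volume)
    (hu : ∀ h : ℝ × ℝ → ℝ, MemLp h 2 volume →
      Tendsto (fun n => ∫ x, u n x * h x) atTop (𝓝 (∫ x, u₀ x * h x)))
    (hz : ∀ h : ℝ × ℝ → ℝ, MemLp h 2 volume →
      Tendsto (fun n => ∫ x, √(harmonicPotential x) * u n x * h x) atTop (𝓝 (∫ x, z x * h x))) :
    z =ᵐ[volume] fun x => √(harmonicPotential x) * u₀ x := by
  refine ae_eq_of_integral_contDiff_smul_eq (hz₀.locallyIntegrable (by norm_num)) ?_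
    fun φ hφ hφc => ?_
  · exact (hu₀.locallyIntegrable (by norm_num)).continuous_mul continuous_sqrt_harmonicPotential
  · have ht : IsTestFunction φ := ⟨hφ, hφc⟩
    have h1 := hz φ (ht.memLp 2)
    have h2 := hu _ (ht.continuous_mul_memLp continuous_sqrt_harmonicPotential 2)
    simp only [smul_eq_mul]
    have h3 : ∀ n, ∫ x, √(harmonicPotential x) * u n x * φ x =
        ∫ x, u n x * (√(harmonicPotential x) * φ x) := fun n =>
      integral_congr_ae (ae_of_all _ fun x => by simp only; ring)
    simp only [h3] at h1
    have h4 := tendsto_nhds_unique h1 h2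
    calc ∫ x, φ x * z x = ∫ x, z x * φ x := by simp only [mul_comm]
      _ = _ := h4
      _ = _ := integral_congr_ae (ae_of_all _ fun x => by simp only; ring)

/-- Sets bounded in the form norm are relatively compact in `L²`, and the form is lower
semicontinuous along the convergent subsequence. -/
theorem exists_subseq_tendsto_of_formNormSq_le {u p q : ℕ → ℝ × ℝ → ℝ}
    (h : ∀ n, FormDomain (u n) (p n) (q n)) {C : ℝ}
    (hC : ∀ n, formNormSq (u n) (p n) (q n) ≤ C) :
    ∃ u₀ p₀ q₀ : ℝ × ℝ → ℝ, FormDomain u₀ p₀ q₀ ∧ ∃ ns : ℕ → ℕ, StrictMono ns ∧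
      Tendsto (fun n => ∫ x, (u (ns n) x - u₀ x) ^ 2) atTop (𝓝 0) ∧
      ∀ δ : ℝ, 0 < δ → ∀ᶠ n in atTop,
        formEnergy u₀ p₀ q₀ ≤ formEnergy (u (ns n)) (p (ns n)) (q (ns n)) + δ := by
  have hpC : ∀ n, ∫ x, p n x ^ 2 ≤ C := fun n =>
    (le_add_of_nonneg_right (integral_sq_nonneg _)).trans
      ((integral_grad_sq_le_formNormSq _ _ _).trans (hC n))
  have hqC : ∀ n, ∫ x, q n x ^ 2 ≤ C := fun n =>
    (le_add_of_nonneg_left (integral_sq_nonneg _)).trans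
      ((integral_grad_sq_le_formNormSq _ _ _).trans (hC n))
  have hzC : ∀ n, ∫ x, (√(harmonicPotential x) * u n x) ^ 2 ≤ C := fun n => by
    simp only [FormDomain.sqrt_potential_mul_sq]
    exact (integral_potential_le_formNormSq _ _ _).trans (hC n)
  -- Four successive extractions, each inside the previous one, so all four weak limits hold along
  -- the composite `ns`.
  obtain ⟨u₀, hu₀, n₁, hn₁, w₁⟩ := exists_subseq_weakly_tendsto (fun n => (h n).memLp)
    (fun n => (integral_sq_le_formNormSq _ _ _).trans (hC n))
  obtain ⟨p₀, hp₀, n₂, hn₂, w₂⟩ := exists_subseq_weakly_tendsto (fun n => (h (n₁ n)).memLp_rho)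
    (fun n => hpC (n₁ n))
  obtain ⟨q₀, hq₀, n₃, hn₃, w₃⟩ := exists_subseq_weakly_tendsto
    (fun n => (h (n₁ (n₂ n))).memLp_sigma) (fun n => hqC (n₁ (n₂ n)))
  obtain ⟨z, hz, n₄, hn₄, w₄⟩ := exists_subseq_weakly_tendsto
    (fun n => (h (n₁ (n₂ (n₃ n)))).memLp_potential) (fun n => hzC (n₁ (n₂ (n₃ n))))
  set ns : ℕ → ℕ := fun n => n₁ (n₂ (n₃ (n₄ n))) with hns
  have wu : ∀ g : ℝ × ℝ → ℝ, MemLp g 2 volume →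
      Tendsto (fun n => ∫ x, u (ns n) x * g x) atTop (𝓝 (∫ x, u₀ x * g x)) := fun g hg =>
    (w₁ g hg).comp ((hn₂.comp (hn₃.comp hn₄)).tendsto_atTop)
  have wp : ∀ g : ℝ × ℝ → ℝ, MemLp g 2 volume →
      Tendsto (fun n => ∫ x, p (ns n) x * g x) atTop (𝓝 (∫ x, p₀ x * g x)) := fun g hg =>
    (w₂ g hg).comp ((hn₃.comp hn₄).tendsto_atTop)
  have wq : ∀ g : ℝ × ℝ → ℝ, MemLp g 2 volume →
      Tendsto (fun n => ∫ x, q (ns n) x * g x) atTop (𝓝 (∫ x, q₀ x * g x)) := fun g hg =>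
    (w₃ g hg).comp hn₄.tendsto_atTop
  have hzu := eq_sqrt_potential_mul_of_weakly_tendsto hu₀ hz wu w₄
  have hf : FormDomain u₀ p₀ q₀ :=
    { memLp := hu₀
      memLp_rho := hp₀
      memLp_sigma := hq₀
      weakDeriv_rho := IsWeakDeriv.of_weakly_tendsto (fun n => (h (ns n)).weakDeriv_rho) wu wp
      weakDeriv_sigma := IsWeakDeriv.of_weakly_tendsto (fun n => (h (ns n)).weakDeriv_sigma) wu wq
      memLp_weight := (memLp_weight_iff hu₀).2 ((memLp_congr_ae hzu).1 hz) }
  refine ⟨u₀, p₀, q₀, hf, ns, hn₁.comp (hn₂.comp (hn₃.comp hn₄)), ?_, fun δ hδ => ?_⟩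
  · refine tendsto_integral_sq_of_weakly_tendsto_zero (fun n => (h (ns n)).sub hf)
      (C := 2 * C + 2 * formNormSq u₀ p₀ q₀) (fun n => ?_) fun g hg => ?_
    · have := (h (ns n)).formNormSq_add_le (hf.const_mul (-1))
      have e : formNormSq (fun x => -1 * u₀ x) (fun x => -1 * p₀ x) (fun x => -1 * q₀ x) =
          formNormSq u₀ p₀ q₀ := by simp [formNormSq]
      rw [e] at this
      simp only [neg_mul, one_mul, ← sub_eq_add_neg] at this
      linarith [hC (ns n)]
    · have h1 := (wu g hg).sub_const (∫ x, u₀ x * g x)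
      rw [sub_self] at h1
      refine h1.congr fun n => ?_
      simp only [sub_mul]
      rw [integral_sub ((h (ns n)).memLp.integrable_mul_two hg) (hu₀.integrable_mul_two hg)]
  · have e1 := eventually_integral_sq_le_of_weakly_tendsto (fun n => (h (ns n)).memLp_rho) hp₀
      (wp p₀ hp₀) (show 0 < δ / 3 by positivity)
    have e2 := eventually_integral_sq_le_of_weakly_tendsto (fun n => (h (ns n)).memLp_sigma) hq₀
      (wq q₀ hq₀) (show 0 < δ / 3 by positivity)
    have e3 := eventually_integral_sq_le_of_weakly_tendsto (fun n => (h (ns n)).memLp_potential) hz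
      (w₄ z hz) (show 0 < δ / 3 by positivity)
    filter_upwards [e1, e2, e3] with n h1 h2 h3
    have h4 : ∫ x, z x ^ 2 = ∫ x, harmonicPotential x * u₀ x ^ 2 := by
      refine integral_congr_ae ?_
      filter_upwards [hzu] with x hx
      rw [hx, FormDomain.sqrt_potential_mul_sq]
    rw [h4] at h3
    simp only [FormDomain.sqrt_potential_mul_sq] at h3
    unfold formEnergy
    linarith

/-! ### The bottom of the harmonic oscillator -/

/-- The commutator of ∂_e and multiplication by l is 1: integrating by parts, the integral I on the
left satisfies I + ∫ φ² = -I. -/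
theorem IsTestFunction.integral_linear_mul_fderiv {φ : ℝ × ℝ → ℝ} (hφ : IsTestFunction φ)
    (l : ℝ × ℝ →L[ℝ] ℝ) (e : ℝ × ℝ) (hl : l e = 1) :
    ∫ x, l x * φ x * fderiv ℝ φ x e = -(1 / 2) * ∫ x, φ x ^ 2 := by
  have ht := hφ.smooth_mul l.contDiff
  have h1 := hφ.isWeakDeriv (e := e) _ ht
  have h2 : ∀ x, fderiv ℝ (fun x => l x * φ x) x e = l x * fderiv ℝ φ x e + φ x := by
    intro x
    rw [fderiv_fun_mul l.differentiableAt (hφ.differentiable x)]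
    simp [hl]
  have h3 : ∫ x, φ x * fderiv ℝ (fun x => l x * φ x) x e =
      (∫ x, l x * φ x * fderiv ℝ φ x e) + ∫ x, φ x ^ 2 := by
    rw [← integral_add ((ht.memLp 2).integrable_mul_two ((hφ.fderiv_apply e).memLp 2))
      (hφ.memLp 2).integrable_sq]
    exact integral_congr_ae (ae_of_all _ fun x => by simp only [h2]; ring)
  have h4 : ∫ x, fderiv ℝ φ x e * (l x * φ x) = ∫ x, l x * φ x * fderiv ℝ φ x e :=
    integral_congr_ae (ae_of_all _ fun x => by simp only; ring)
  rw [h3, h4] at h1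
  linarith

namespace FormDomain

variable {u p q : ℝ × ℝ → ℝ}

/-- Extends the commutator identity by density; convergence in the potential term controls ρφ_n in
`L²`. -/
theorem integral_fst_mul_rho (h : FormDomain u p q) :
    ∫ x, x.1 * u x * p x = -(1 / 2) * ∫ x, u x ^ 2 := by
  obtain ⟨φ, hφ, h1, h2, -, h4⟩ := h.exists_test_seq_tendsto
  have l1 := tendsto_integral_sq_of_tendsto (fun n => (hφ n).memLp 2) h.memLp h1
  have hm : ∀ n, MemLp (fun x => x.1 * φ n x) 2 volume := fun n =>
    (hφ n).continuous_mul_memLp continuous_fst 2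
  have l2 : Tendsto (fun n => ∫ x, (x.1 * φ n x - x.1 * u x) ^ 2) atTop (𝓝 0) := by
    refine squeeze_zero (fun n => integral_sq_nonneg _) (fun n => ?_) h4
    refine integral_mono ((hm n).sub_two h.memLp_fst_mul).integrable_sq
      ((hφ n).formDomain.sub h).integrable_potential fun x => ?_
    simp only [harmonicPotential]
    nlinarith [mul_nonneg (sq_nonneg x.1) (sq_nonneg (φ n x - u x)),
      mul_nonneg (sq_nonneg x.2) (sq_nonneg (φ n x - u x))]
  have l3 := tendsto_integral_mul_of_tendsto hm (fun n => (hφ n).dRho.memLp 2) h.memLp_fst_mul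
    h.memLp_rho l2 h2
  refine tendsto_nhds_unique l3 ((l1.const_mul _).congr fun n => ?_)
  exact ((hφ n).integral_linear_mul_fderiv (ContinuousLinearMap.fst ℝ ℝ ℝ) (1, 0) rfl).symm

theorem integral_snd_mul_sigma (h : FormDomain u p q) :
    ∫ x, x.2 * u x * q x = -(1 / 2) * ∫ x, u x ^ 2 := by
  obtain ⟨φ, hφ, h1, -, h3, h4⟩ := h.exists_test_seq_tendsto
  have l1 := tendsto_integral_sq_of_tendsto (fun n => (hφ n).memLp 2) h.memLp h1
  have hm : ∀ n, MemLp (fun x => x.2 * φ n x) 2 volume := fun n =>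
    (hφ n).continuous_mul_memLp continuous_snd 2
  have l2 : Tendsto (fun n => ∫ x, (x.2 * φ n x - x.2 * u x) ^ 2) atTop (𝓝 0) := by
    refine squeeze_zero (fun n => integral_sq_nonneg _) (fun n => ?_) h4
    refine integral_mono ((hm n).sub_two h.memLp_snd_mul).integrable_sq
      ((hφ n).formDomain.sub h).integrable_potential fun x => ?_
    simp only [harmonicPotential]
    nlinarith [mul_nonneg (sq_nonneg x.1) (sq_nonneg (φ n x - u x)),
      mul_nonneg (sq_nonneg x.2) (sq_nonneg (φ n x - u x))]
  have l3 := tendsto_integral_mul_of_tendsto hm (fun n => (hφ n).dSigma.memLp 2) h.memLp_snd_mul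
    h.memLp_sigma l2 h3
  refine tendsto_nhds_unique l3 ((l1.const_mul _).congr fun n => ?_)
  exact ((hφ n).integral_linear_mul_fderiv (ContinuousLinearMap.snd ℝ ℝ ℝ) (0, 1) rfl).symm

theorem memLp_annihilation_rho (h : FormDomain u p q) :
    MemLp (fun x => p x + 2 * (x.1 * u x)) 2 volume :=
  h.memLp_rho.add (h.memLp_fst_mul.const_mul 2)

theorem memLp_annihilation_sigma (h : FormDomain u p q) :
    MemLp (fun x => q x + x.2 * u x) 2 volume :=
  h.memLp_sigma.add h.memLp_snd_mul

/-- Factorisation of the harmonic oscillator by annihilation operators. -/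
theorem formEnergy_eq (h : FormDomain u p q) :
    formEnergy u p q = (∫ x, (p x + 2 * (x.1 * u x)) ^ 2) + (∫ x, (q x + x.2 * u x) ^ 2) +
      3 * ∫ x, u x ^ 2 := by
  have i1 := h.memLp_rho.integrable_sq
  have i2 : Integrable fun x => 4 * (x.1 * u x * p x) :=
    (h.memLp_fst_mul.integrable_mul_two h.memLp_rho).const_mul 4
  have i3 : Integrable fun x => 4 * (x.1 * u x) ^ 2 := h.memLp_fst_mul.integrable_sq.const_mul 4
  have j1 := h.memLp_sigma.integrable_sq
  have j2 : Integrable fun x => 2 * (x.2 * u x * q x) :=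
    (h.memLp_snd_mul.integrable_mul_two h.memLp_sigma).const_mul 2
  have j3 : Integrable fun x => (x.2 * u x) ^ 2 := h.memLp_snd_mul.integrable_sq
  have i12 : Integrable fun x => p x ^ 2 + 4 * (x.1 * u x * p x) := i1.add i2
  have j12 : Integrable fun x => q x ^ 2 + 2 * (x.2 * u x * q x) := j1.add j2
  have e1 : ∫ x, (p x + 2 * (x.1 * u x)) ^ 2 =
      (∫ x, p x ^ 2) + 4 * (∫ x, x.1 * u x * p x) + ∫ x, 4 * (x.1 * u x) ^ 2 := by
    rw [← integral_const_mul, ← integral_add i1 i2, ← integral_add i12 i3]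
    exact integral_congr_ae (ae_of_all _ fun x => by ring)
  have e2 : ∫ x, (q x + x.2 * u x) ^ 2 =
      (∫ x, q x ^ 2) + 2 * (∫ x, x.2 * u x * q x) + ∫ x, (x.2 * u x) ^ 2 := by
    rw [← integral_const_mul, ← integral_add j1 j2, ← integral_add j12 j3]
    exact integral_congr_ae (ae_of_all _ fun x => by ring)
  have e3 : ∫ x, harmonicPotential x * u x ^ 2 =
      (∫ x, 4 * (x.1 * u x) ^ 2) + ∫ x, (x.2 * u x) ^ 2 := by
    rw [← integral_add i3 j3]
    exact integral_congr_ae (ae_of_all _ fun x => by simp only [harmonicPotential]; ring)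
  rw [e1, e2, h.integral_fst_mul_rho, h.integral_snd_mul_sigma, formEnergy, e3]
  ring

/-- The lowest eigenvalue is 3 = 2 + 1, one contribution from each commutator. -/
theorem three_mul_integral_sq_le (h : FormDomain u p q) :
    3 * ∫ x, u x ^ 2 ≤ formEnergy u p q := by
  rw [h.formEnergy_eq]
  exact le_add_of_nonneg_left (add_nonneg (integral_sq_nonneg _) (integral_sq_nonneg _))

end FormDomain

theorem mollify_congr_ae (η : ContDiffBump (0 : ℝ × ℝ)) {f g : ℝ × ℝ → ℝ} (h : f =ᵐ[volume] g)
    (x : ℝ × ℝ) : mollify η f x = mollify η g x := by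
  rw [mollify_eq_integral_swap, mollify_eq_integral_swap]
  refine integral_congr_ae ?_
  filter_upwards [h] with y hy
  rw [hy]

/-- A function with vanishing weak gradient is constant. -/
theorem exists_ae_eq_const_of_isWeakDeriv_zero {f p q : ℝ × ℝ → ℝ} (hf : LocallyIntegrable f volume)
    (hp : IsWeakDeriv (1, 0) f p) (hq : IsWeakDeriv (0, 1) f q) (hp0 : p =ᵐ[volume] 0)
    (hq0 : q =ᵐ[volume] 0) : ∃ c : ℝ, ∀ᵐ x, f x = c := by
  have h0 : ∀ (η : ContDiffBump (0 : ℝ × ℝ)) x, mollify η (0 : ℝ × ℝ → ℝ) x = 0 := fun η x => by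
    simp [mollify]
  have hconst : ∀ (n : ℕ) x y, mollify (shrinkingBump n) f x = mollify (shrinkingBump n) f y := by
    intro n
    refine is_const_of_fderiv_eq_zero (𝕜 := ℝ)
      ((contDiff_mollify _ hf).differentiable (by norm_num)) fun x => ?_
    ext
    · have := fderiv_mollify (shrinkingBump n) hf hp x
      rw [mollify_congr_ae _ hp0, h0] at this
      simpa using this
    · have := fderiv_mollify (shrinkingBump n) hf hq x
      rw [mollify_congr_ae _ hq0, h0] at this
      simpa using this
  -- Pointwise a.e. convergence needs a bounded ratio of outer to inner radius; for `shrinkingBump`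
  -- it is exactly 2.
  have hae : ∀ᵐ x, Tendsto (fun n => mollify (shrinkingBump n) f x) atTop (𝓝 (f x)) := by
    simp only [mollify_eq_convolution]
    refine ContDiffBump.ae_convolution_tendsto_right_of_locallyIntegrable (K := 2)
      tendsto_shrinkingBump_rOut (Eventually.of_forall fun n => ?_) hf
    simp only [shrinkingBump]
    rw [one_div, one_div, mul_inv, mul_inv_cancel_left₀ two_ne_zero]
  obtain ⟨x₀, hx₀⟩ := hae.exists
  refine ⟨f x₀, ?_⟩
  filter_upwards [hae] with x hx
  refine tendsto_nhds_unique hx (hx₀.congr fun n => hconst n x₀ x)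

/-- Minimisers of the harmonic oscillator energy are multiples of the Gaussian. -/
theorem FormDomain.exists_eq_const_mul_exp {u p q : ℝ × ℝ → ℝ} (h : FormDomain u p q)
    (hle : formEnergy u p q ≤ 3 * ∫ x, u x ^ 2) :
    ∃ c : ℝ, ∀ᵐ x, u x = c * Real.exp (-(x.1 ^ 2 + x.2 ^ 2 / 2)) := by
  rw [h.formEnergy_eq] at hle
  have n1 := integral_sq_nonneg (μ := volume) fun x => p x + 2 * (x.1 * u x)
  have n2 := integral_sq_nonneg (μ := volume) fun x => q x + x.2 * u x
  have z1 := (integral_eq_zero_iff_of_nonneg (fun x => sq_nonneg _)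
    h.memLp_annihilation_rho.integrable_sq).1 (le_antisymm (by linarith) n1)
  have z2 := (integral_eq_zero_iff_of_nonneg (fun x => sq_nonneg _)
    h.memLp_annihilation_sigma.integrable_sq).1 (le_antisymm (by linarith) n2)
  -- Integrating factor: ∂_ρ(Gu) = G(∂_ρ u + 2ρu) and ∂_σ(Gu) = G(∂_σ u + σu), and both brackets
  -- vanish a.e.
  let G : ℝ × ℝ → ℝ := fun x => Real.exp (x.1 ^ 2 + x.2 ^ 2 / 2)
  have hG : ContDiff ℝ ∞ G := by
    simp only [G]
    fun_prop
  have hGd : ∀ x e, fderiv ℝ G x e = G x * (2 * x.1 * e.1 + x.2 * e.2) := by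
    intro x e
    have h1 : HasFDerivAt (fun x : ℝ × ℝ => x.1 ^ 2 + x.2 ^ 2 / 2)
        ((2 * x.1) • ContinuousLinearMap.fst ℝ ℝ ℝ + x.2 • ContinuousLinearMap.snd ℝ ℝ ℝ) x := by
      have h2 := (hasFDerivAt_fst (𝕜 := ℝ) (p := x)).pow 2
      have h3 := ((hasFDerivAt_snd (𝕜 := ℝ) (p := x)).pow 2).mul_const (1 / 2 : ℝ)
      refine ((h2.add h3).congr_fderiv ?_).congr_of_eventuallyEq (Eventually.of_forall fun y => ?_)
      · ext <;> simp
      · simp only [Pi.add_apply]; ring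
    rw [h1.exp.fderiv]
    simp [G, mul_add]
  have hul := h.memLp.locallyIntegrable (by norm_num)
  have w1 := h.weakDeriv_rho.smooth_mul hG hul (h.memLp_rho.locallyIntegrable (by norm_num))
  have w2 := h.weakDeriv_sigma.smooth_mul hG hul (h.memLp_sigma.locallyIntegrable (by norm_num))
  obtain ⟨c, hc⟩ := exists_ae_eq_const_of_isWeakDeriv_zero (hul.continuous_mul hG.continuous) w1 w2
    (by
      filter_upwards [z1] with x hx
      have hx' : p x + 2 * (x.1 * u x) = 0 := by simpa using hx
      rw [hGd]
      simp only [Pi.zero_apply]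
      linear_combination G x * hx')
    (by
      filter_upwards [z2] with x hx
      have hx' : q x + x.2 * u x = 0 := by simpa using hx
      rw [hGd]
      simp only [Pi.zero_apply]
      linear_combination G x * hx')
  refine ⟨c, ?_⟩
  filter_upwards [hc] with x hx
  rw [← hx, Real.exp_neg]
  simp only [G]
  field_simp

/-! ### The normalised Gaussian -/

section Gaussian

theorem integrable_exp_neg_mul_sq_prod {a b : ℝ} (ha : 0 < a) (hb : 0 < b) :
    Integrable fun x : ℝ × ℝ => Real.exp (-a * x.1 ^ 2) * Real.exp (-b * x.2 ^ 2) :=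
  (integrable_exp_neg_mul_sq ha).mul_prod (integrable_exp_neg_mul_sq hb)

theorem integral_exp_neg_mul_sq_prod (a b : ℝ) :
    ∫ x : ℝ × ℝ, Real.exp (-a * x.1 ^ 2) * Real.exp (-b * x.2 ^ 2) =
      √(Real.pi / a) * √(Real.pi / b) := by
  rw [← integral_gaussian, ← integral_gaussian]
  exact integral_prod_mul (fun x : ℝ => Real.exp (-a * x ^ 2)) fun y : ℝ => Real.exp (-b * y ^ 2)

theorem memLp_exp_neg_radius_sq :
    MemLp (fun x : ℝ × ℝ => Real.exp (-(x.1 ^ 2 + x.2 ^ 2) / 4)) 2 volume := by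
  rw [memLp_two_iff_integrable_sq (by fun_prop)]
  refine (integrable_exp_neg_mul_sq_prod (a := 1 / 2) (b := 1 / 2) (by norm_num)
    (by norm_num)).congr (ae_of_all _ fun x => ?_)
  simp only [← Real.exp_add, ← Real.exp_nat_mul]
  congr 1
  push_cast
  ring

theorem gaussian_const_sq :
    ((2 : ℝ) ^ (1 / 4 : ℝ) * Real.pi ^ (-(1 / 2) : ℝ)) ^ 2 = √2 / Real.pi := by
  rw [mul_pow, ← Real.rpow_natCast, ← Real.rpow_natCast, ← Real.rpow_mul (by norm_num),
    ← Real.rpow_mul Real.pi_pos.le, Real.sqrt_eq_rpow]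
  norm_num [Real.rpow_neg_one]
  exact (div_eq_mul_inv _ _).symm

theorem gaussian_const_pos : 0 < (2 : ℝ) ^ (1 / 4 : ℝ) * Real.pi ^ (-(1 / 2) : ℝ) := by
  have := Real.pi_pos
  positivity

theorem gaussianU0_pos (x : ℝ × ℝ) : 0 < gaussianU0 x :=
  mul_pos gaussian_const_pos (Real.exp_pos _)

theorem integral_gaussianU0_sq : ∫ x, gaussianU0 x ^ 2 = 1 := by
  have h1 : ∀ x, gaussianU0 x ^ 2 =
      √2 / Real.pi * (Real.exp (-2 * x.1 ^ 2) * Real.exp (-1 * x.2 ^ 2)) := by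
    intro x
    rw [gaussianU0, mul_pow, gaussian_const_sq, ← Real.exp_add, ← Real.exp_nat_mul]
    congr 2
    push_cast
    ring
  simp only [h1]
  rw [integral_const_mul, integral_exp_neg_mul_sq_prod, div_one,
    Real.sqrt_div Real.pi_pos.le]
  have h2 := Real.mul_self_sqrt Real.pi_pos.le
  have h3 : √2 ≠ 0 := by positivity
  have := Real.pi_pos.ne'
  field_simp
  linarith

theorem integral_gaussianU0_pow_four : ∫ x, gaussianU0 x ^ 4 = √2 / (2 * Real.pi) := by
  have h1 : ∀ x, gaussianU0 x ^ 4 =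
      2 / Real.pi ^ 2 * (Real.exp (-4 * x.1 ^ 2) * Real.exp (-2 * x.2 ^ 2)) := by
    intro x
    have e : ((2 : ℝ) ^ (1 / 4 : ℝ) * Real.pi ^ (-(1 / 2) : ℝ)) ^ 4 = 2 / Real.pi ^ 2 := by
      rw [show 4 = 2 * 2 by norm_num, pow_mul, gaussian_const_sq, div_pow, Real.sq_sqrt zero_le_two]
    rw [gaussianU0, mul_pow, e, ← Real.exp_add, ← Real.exp_nat_mul]
    congr 2
    push_cast
    ring
  simp only [h1]
  rw [integral_const_mul, integral_exp_neg_mul_sq_prod, Real.sqrt_div Real.pi_pos.le,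
    Real.sqrt_div Real.pi_pos.le, show √(4 : ℝ) = 2 by
      rw [show (4 : ℝ) = 2 ^ 2 by norm_num, Real.sqrt_sq zero_le_two]]
  have h2 := Real.mul_self_sqrt Real.pi_pos.le
  have h4 := Real.mul_self_sqrt (zero_le_two (α := ℝ))
  have h3 : √2 ≠ 0 := by positivity
  have := Real.pi_pos.ne'
  field_simp
  nlinarith

theorem contDiff_gaussianU0 : ContDiff ℝ ∞ gaussianU0 := by
  unfold gaussianU0
  fun_prop

theorem fderiv_gaussianU0 (x e : ℝ × ℝ) :
    fderiv ℝ gaussianU0 x e = -(2 * x.1 * e.1 + x.2 * e.2) * gaussianU0 x := by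
  have h1 : HasFDerivAt (fun x : ℝ × ℝ => -(x.1 ^ 2 + x.2 ^ 2 / 2))
      (-((2 * x.1) • ContinuousLinearMap.fst ℝ ℝ ℝ + x.2 • ContinuousLinearMap.snd ℝ ℝ ℝ)) x := by
    have h2 := (hasFDerivAt_fst (𝕜 := ℝ) (p := x)).pow 2
    have h3 := ((hasFDerivAt_snd (𝕜 := ℝ) (p := x)).pow 2).mul_const (1 / 2 : ℝ)
    refine ((h2.add h3).neg.congr_fderiv ?_).congr_of_eventuallyEq
      (Eventually.of_forall fun y => ?_)
    · ext <;> simp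
    · simp only [Pi.add_apply, Pi.neg_apply]; ring
  have h4 := (h1.exp.const_mul ((2 : ℝ) ^ (1 / 4 : ℝ) * Real.pi ^ (-(1 / 2) : ℝ))).fderiv
  have h5 : fderiv ℝ gaussianU0 x = _ := h4
  rw [h5, gaussianU0]
  simp
  ring

theorem gaussianU0_le (x : ℝ × ℝ) : gaussianU0 x ≤
    (2 : ℝ) ^ (1 / 4 : ℝ) * Real.pi ^ (-(1 / 2) : ℝ) *
      Real.exp (-(x.1 ^ 2 + x.2 ^ 2) / 2) := by
  refine mul_le_mul_of_nonneg_left (Real.exp_le_exp.2 ?_) gaussian_const_pos.le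
  nlinarith [sq_nonneg x.1]

/-- With r² = ρ² + σ², the Gaussian decays at least like exp(-r²/2). Half of this absorbs the growth
of `a`, as 1 + r²/4 ≤ exp(r²/4), and the other half is in `L²`. -/
theorem memLp_mul_gaussianU0 {a : ℝ × ℝ → ℝ} (ha : Continuous a) {C : ℝ}
    (hC : ∀ x, |a x| ≤ C * (1 + (x.1 ^ 2 + x.2 ^ 2) / 4)) :
    MemLp (fun x => a x * gaussianU0 x) 2 volume := by
  refine memLp_exp_neg_radius_sq.of_le_mul
    (c := C * ((2 : ℝ) ^ (1 / 4 : ℝ) * Real.pi ^ (-(1 / 2) : ℝ)))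
    (ha.mul contDiff_gaussianU0.continuous).aestronglyMeasurable (ae_of_all _ fun x => ?_)
  have hC0 : 0 ≤ C := by simpa using (abs_nonneg _).trans (hC 0)
  have hc := gaussian_const_pos
  rw [norm_mul, Real.norm_eq_abs, Real.norm_of_nonneg (gaussianU0_pos x).le,
    Real.norm_of_nonneg (Real.exp_pos _).le]
  have h1 : 1 + (x.1 ^ 2 + x.2 ^ 2) / 4 ≤ Real.exp ((x.1 ^ 2 + x.2 ^ 2) / 4) := by
    have := Real.add_one_le_exp ((x.1 ^ 2 + x.2 ^ 2) / 4)
    linarith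
  have h2 : Real.exp ((x.1 ^ 2 + x.2 ^ 2) / 4) * Real.exp (-(x.1 ^ 2 + x.2 ^ 2) / 2) =
      Real.exp (-(x.1 ^ 2 + x.2 ^ 2) / 4) := by
    rw [← Real.exp_add]
    congr 1
    ring
  calc |a x| * gaussianU0 x ≤ C * Real.exp ((x.1 ^ 2 + x.2 ^ 2) / 4) *
        ((2 : ℝ) ^ (1 / 4 : ℝ) * Real.pi ^ (-(1 / 2) : ℝ) *
          Real.exp (-(x.1 ^ 2 + x.2 ^ 2) / 2)) :=
        mul_le_mul ((hC x).trans (mul_le_mul_of_nonneg_left h1 hC0)) (gaussianU0_le x)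
          (gaussianU0_pos x).le (by positivity)
    _ = _ := by rw [← h2]; ring

theorem memLp_gaussianU0 : MemLp gaussianU0 2 volume := by
  have := memLp_mul_gaussianU0 (a := fun _ => 1) continuous_const (C := 1) fun x => by
    rw [abs_one]
    nlinarith [sq_nonneg x.1, sq_nonneg x.2]
  simpa only [one_mul] using this

theorem isWeakDeriv_gaussianU0 {e : ℝ × ℝ}
    (h : MemLp (fun x => -(2 * x.1 * e.1 + x.2 * e.2) * gaussianU0 x) 2 volume) :
    IsWeakDeriv e gaussianU0 (fun x => -(2 * x.1 * e.1 + x.2 * e.2) * gaussianU0 x) := by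
  intro φ hφ
  simp only [← fderiv_gaussianU0] at h ⊢
  exact integral_mul_fderiv_eq_neg_fderiv_mul_of_integrable
    (h.integrable_mul_two (hφ.memLp 2))
    (memLp_gaussianU0.integrable_mul_two ((hφ.fderiv_apply e).memLp 2))
    (memLp_gaussianU0.integrable_mul_two (hφ.memLp 2))
    (fun x _ => contDiff_gaussianU0.differentiable (by norm_num) x)
    (fun x _ => hφ.differentiable x)

theorem formDomain_gaussianU0 : FormDomain gaussianU0 (fun x => -2 * (x.1 * gaussianU0 x))
    (fun x => -(x.2 * gaussianU0 x)) := by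
  have b1 : ∀ x : ℝ × ℝ, |x.1| ≤ 1 + (x.1 ^ 2 + x.2 ^ 2) / 4 := fun x => by
    rw [← sq_abs x.1]
    nlinarith [sq_nonneg (|x.1| / 2 - 1), sq_nonneg x.2]
  have b2 : ∀ x : ℝ × ℝ, |x.2| ≤ 1 + (x.1 ^ 2 + x.2 ^ 2) / 4 := fun x => by
    rw [← sq_abs x.2]
    nlinarith [sq_nonneg (|x.2| / 2 - 1), sq_nonneg x.1]
  have b3 : ∀ x : ℝ × ℝ, |√(x.1 ^ 2 + x.2 ^ 2)| ≤ 1 * (1 + (x.1 ^ 2 + x.2 ^ 2) / 4) := fun x => by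
    rw [abs_of_nonneg (Real.sqrt_nonneg _)]
    nlinarith [sq_nonneg (√(x.1 ^ 2 + x.2 ^ 2) / 2 - 1),
      Real.sq_sqrt (show 0 ≤ x.1 ^ 2 + x.2 ^ 2 by positivity)]
  have m1 := memLp_mul_gaussianU0 (a := fun x => x.1) continuous_fst (C := 1)
    fun x => by simpa using b1 x
  have m2 := memLp_mul_gaussianU0 (a := fun x => x.2) continuous_snd (C := 1)
    fun x => by simpa using b2 x
  have e1 : (fun x : ℝ × ℝ => -(2 * x.1 * (1, (0 : ℝ)).1 + x.2 * ((1 : ℝ), (0 : ℝ)).2) *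
      gaussianU0 x) = fun x => -2 * (x.1 * gaussianU0 x) := by
    ext x; simp; ring
  have e2 : (fun x : ℝ × ℝ => -(2 * x.1 * (0, (1 : ℝ)).1 + x.2 * ((0 : ℝ), (1 : ℝ)).2) *
      gaussianU0 x) = fun x => -(x.2 * gaussianU0 x) := by
    ext x; simp
  have w1 := isWeakDeriv_gaussianU0 (e := (1, 0)) (by rw [e1]; exact m1.const_mul (-2))
  have w2 := isWeakDeriv_gaussianU0 (e := (0, 1)) (by rw [e2]; exact m2.neg)
  rw [e1] at w1
  rw [e2] at w2
  exact ⟨memLp_gaussianU0, m1.const_mul (-2), m2.neg, w1, w2,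
    memLp_mul_gaussianU0 (by fun_prop) b3⟩

/-- Both annihilation operators kill the Gaussian, so only the constant term of the factorisation is
left. -/
theorem formEnergy_gaussianU0 : formEnergy gaussianU0 (fun x => -2 * (x.1 * gaussianU0 x))
    (fun x => -(x.2 * gaussianU0 x)) = 3 := by
  rw [formDomain_gaussianU0.formEnergy_eq, integral_gaussianU0_sq]
  simp

/-- The Gaussian is the unique nonnegative normalised minimiser of the harmonic oscillator
energy. -/
theorem FormDomain.ae_eq_gaussianU0 {u p q : ℝ × ℝ → ℝ} (h : FormDomain u p q)
    (hu : ∫ x, u x ^ 2 = 1) (hpos : ∀ᵐ x, 0 ≤ u x) (hle : formEnergy u p q ≤ 3) :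
    u =ᵐ[volume] gaussianU0 := by
  obtain ⟨c, hc⟩ := h.exists_eq_const_mul_exp (by rw [hu]; linarith)
  set k := (2 : ℝ) ^ (1 / 4 : ℝ) * Real.pi ^ (-(1 / 2) : ℝ) with hk
  have hk0 : 0 < k := gaussian_const_pos
  have h1 : u =ᵐ[volume] fun x => c / k * gaussianU0 x := by
    filter_upwards [hc] with x hx
    rw [hx, gaussianU0, ← hk]
    field_simp
  -- The sign is read off at a single point where u ≥ 0, the Gaussian being positive everywhere.
  have h2 : 0 ≤ c / k := by
    obtain ⟨x, hx, hx'⟩ := (h1.and hpos).exists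
    rw [hx] at hx'
    exact nonneg_of_mul_nonneg_left hx' (gaussianU0_pos x)
  have h3 : (c / k) ^ 2 = 1 := by
    have e : ∫ x, u x ^ 2 = ∫ x, (c / k) ^ 2 * gaussianU0 x ^ 2 := by
      refine integral_congr_ae ?_
      filter_upwards [h1] with x hx
      rw [hx, mul_pow]
    rw [← hu, e, integral_const_mul, integral_gaussianU0_sq, mul_one]
  have h4 : c / k = 1 := by nlinarith
  rw [h4] at h1
  simpa using h1

end Gaussian

/-! ### Closedness of the form and absolute values -/

theorem ae_eq_of_tendsto_integral_sub_sq {u : ℕ → ℝ × ℝ → ℝ} {f g : ℝ × ℝ → ℝ}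
    (hu : ∀ n, MemLp (u n) 2 volume) (hf : MemLp f 2 volume) (hg : MemLp g 2 volume)
    (h1 : Tendsto (fun n => ∫ x, (u n x - f x) ^ 2) atTop (𝓝 0))
    (h2 : Tendsto (fun n => ∫ x, (u n x - g x) ^ 2) atTop (𝓝 0)) : f =ᵐ[volume] g := by
  obtain ⟨ns, hns, hae⟩ := exists_subseq_tendsto_ae_of_tendsto hu hf h1
  obtain ⟨ms, hms, hae'⟩ := exists_subseq_tendsto_ae_of_tendsto (fun n => hu (ns n)) hg
    (h2.comp hns.tendsto_atTop)
  filter_upwards [hae, hae'] with x hx hx'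
  exact tendsto_nhds_unique (hx.comp hms.tendsto_atTop) hx'

theorem FormDomain.congr_ae {u u' p q : ℝ × ℝ → ℝ} (h : FormDomain u p q)
    (hu : u =ᵐ[volume] u') : FormDomain u' p q where
  memLp := (memLp_congr_ae hu).1 h.memLp
  memLp_rho := h.memLp_rho
  memLp_sigma := h.memLp_sigma
  weakDeriv_rho := h.weakDeriv_rho.congr_ae hu
  weakDeriv_sigma := h.weakDeriv_sigma.congr_ae hu
  memLp_weight := by
    refine (memLp_congr_ae ?_).1 h.memLp_weight
    filter_upwards [hu] with x hx
    rw [hx]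

theorem formEnergy_congr_ae {u u' p q : ℝ × ℝ → ℝ} (hu : u =ᵐ[volume] u') :
    formEnergy u p q = formEnergy u' p q := by
  unfold formEnergy
  congr 1
  refine integral_congr_ae ?_
  filter_upwards [hu] with x hx
  rw [hx]

/-- The form is closed: an `L²` limit of a sequence of bounded energy is in the form domain. -/
theorem exists_formDomain_of_tendsto {u p q : ℕ → ℝ × ℝ → ℝ} {g : ℝ × ℝ → ℝ}
    (h : ∀ n, FormDomain (u n) (p n) (q n)) (hg : MemLp g 2 volume)
    (hlim : Tendsto (fun n => ∫ x, (u n x - g x) ^ 2) atTop (𝓝 0)) {L : ℕ → ℝ} {ℓ : ℝ}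
    (hE : ∀ n, formEnergy (u n) (p n) (q n) ≤ L n) (hL : Tendsto L atTop (𝓝 ℓ)) :
    ∃ p₀ q₀ : ℝ × ℝ → ℝ, FormDomain g p₀ q₀ ∧ formEnergy g p₀ q₀ ≤ ℓ := by
  obtain ⟨A, hA⟩ := (tendsto_integral_sq_of_tendsto (fun n => (h n).memLp) hg hlim).bddAbove_range
  obtain ⟨B, hB⟩ := hL.bddAbove_range
  obtain ⟨u₀, p₀, q₀, h₀, ns, hns, hl, hlsc⟩ := exists_subseq_tendsto_of_formNormSq_le h
    (C := A + B) fun n => by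
      rw [formNormSq_eq]
      exact add_le_add (hA (Set.mem_range_self n)) ((hE n).trans (hB (Set.mem_range_self n)))
  have hae := ae_eq_of_tendsto_integral_sub_sq (fun n => (h (ns n)).memLp) h₀.memLp hg hl
    (hlim.comp hns.tendsto_atTop)
  refine ⟨p₀, q₀, h₀.congr_ae hae, ?_⟩
  rw [← formEnergy_congr_ae hae]
  refine le_of_forall_pos_le_add fun δ hδ => ?_
  refine ge_of_tendsto ((hL.comp hns.tendsto_atTop).add_const δ) ?_
  filter_upwards [hlsc δ hδ] with n hn
  exact hn.trans (add_le_add_left (hE (ns n)) δ)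

section AbsoluteValue

/-- A smooth regularisation of |t|. Subtracting ε makes it vanish at 0, so composition with it keeps
compact support. -/
theorem sqrt_sq_add_sq_sub_bounds (t : ℝ) {ε : ℝ} (hε : 0 < ε) :
    0 ≤ √(t ^ 2 + ε ^ 2) - ε ∧ √(t ^ 2 + ε ^ 2) - ε ≤ |t| ∧ |t| - ε ≤ √(t ^ 2 + ε ^ 2) - ε := by
  have h1 : √(t ^ 2 + ε ^ 2) ≤ |t| + ε := by
    refine Real.sqrt_le_iff.2 ⟨by positivity, ?_⟩
    rw [← sq_abs t]
    nlinarith [abs_nonneg t]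
  have h2 : |t| ≤ √(t ^ 2 + ε ^ 2) := Real.abs_le_sqrt (by nlinarith)
  have h3 : ε ≤ √(t ^ 2 + ε ^ 2) := Real.le_sqrt_of_sq_le (by nlinarith)
  exact ⟨by linarith, by linarith, by linarith⟩

theorem IsTestFunction.sqrt_sq_add_sq_sub {φ : ℝ × ℝ → ℝ} (hφ : IsTestFunction φ) {ε : ℝ}
    (hε : 0 < ε) : IsTestFunction fun x => √(φ x ^ 2 + ε ^ 2) - ε := by
  refine ⟨((hφ.1.pow 2).add contDiff_const).sqrt (fun x => by positivity) |>.sub contDiff_const, ?_⟩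
  exact hφ.2.comp_left (g := fun t => √(t ^ 2 + ε ^ 2) - ε) (by simp [Real.sqrt_sq hε.le])

theorem IsTestFunction.fderiv_sqrt_sq_add_sq_sub_sq_le {φ : ℝ × ℝ → ℝ} (hφ : IsTestFunction φ)
    {ε : ℝ} (hε : 0 < ε) (x e : ℝ × ℝ) :
    fderiv ℝ (fun x => √(φ x ^ 2 + ε ^ 2) - ε) x e ^ 2 ≤ fderiv ℝ φ x e ^ 2 := by
  have hpos : 0 < φ x ^ 2 + ε ^ 2 := by positivity
  have h1 := ((((hφ.differentiable x).hasFDerivAt.pow 2).add_const (ε ^ 2)).sqrt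
    hpos.ne').sub_const ε
  rw [h1.fderiv]
  simp only [smul_apply, smul_eq_mul]
  have h2 := Real.sq_sqrt hpos.le
  have h3 : 0 < √(φ x ^ 2 + ε ^ 2) := Real.sqrt_pos.2 hpos
  set s := √(φ x ^ 2 + ε ^ 2)
  set d := fderiv ℝ φ x e
  have h4 : 1 / (2 * s) * ((2 : ℕ) • φ x ^ (2 - 1) * d) = (φ x / s) * d := by
    simp; ring
  have h5 : (φ x / s) ^ 2 ≤ 1 := by
    rw [div_pow, h2]
    exact div_le_one_of_le₀ (by nlinarith) hpos.le
  rw [h4, mul_pow]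
  exact mul_le_of_le_one_left (sq_nonneg d) h5

/-- The absolute value of a test function is in the form domain and does not increase energy. -/
theorem IsTestFunction.exists_formDomain_abs {φ : ℝ × ℝ → ℝ} (hφ : IsTestFunction φ) :
    ∃ p q : ℝ × ℝ → ℝ, FormDomain (fun x => |φ x|) p q ∧
      formEnergy (fun x => |φ x|) p q ≤ formEnergy φ (_root_.dRho φ) (_root_.dSigma φ) := by
  have hε : ∀ n : ℕ, 0 < 1 / ((n : ℝ) + 1) := fun n => by positivity
  have hw := fun n : ℕ => hφ.sqrt_sq_add_sq_sub (hε n)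
  have hm : MemLp (fun x => |φ x|) 2 volume := (hφ.memLp 2).abs
  refine exists_formDomain_of_tendsto (fun n => (hw n).formDomain) hm ?_ (fun n => ?_)
    tendsto_const_nhds
  · have : Tendsto (fun n : ℕ => ∫ x, (√(φ x ^ 2 + (1 / ((n : ℝ) + 1)) ^ 2) - 1 / ((n : ℝ) + 1) -
        |φ x|) ^ 2) atTop (𝓝 (∫ _ : ℝ × ℝ, (0 : ℝ))) := by
      refine tendsto_integral_of_dominated_convergence (fun x => φ x ^ 2)
        (fun n => (((hw n).memLp 2).sub_two hm).1.pow 2) (hφ.memLp 2).integrable_sq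
        (fun n => ae_of_all _ fun x => ?_) (ae_of_all _ fun x => ?_)
      · obtain ⟨h1, h2, -⟩ := sqrt_sq_add_sq_sub_bounds (φ x) (hε n)
        rw [Real.norm_of_nonneg (sq_nonneg _)]
        refine sq_le_sq.2 (abs_le.2 ⟨by linarith, ?_⟩)
        linarith [abs_nonneg (φ x)]
      · have h0 : Tendsto (fun n : ℕ => (1 / ((n : ℝ) + 1)) ^ 2) atTop (𝓝 0) := by
          simpa using (tendsto_one_div_add_atTop_nhds_zero_nat (𝕜 := ℝ)).pow 2
        refine squeeze_zero (fun n => sq_nonneg _) (fun n => ?_) h0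
        obtain ⟨-, h2, h3⟩ := sqrt_sq_add_sq_sub_bounds (φ x) (hε n)
        exact sq_le_sq' (by linarith) (by linarith [hε n])
    simpa using this
  · unfold formEnergy
    refine add_le_add (add_le_add ?_ ?_) ?_
    · exact integral_mono ((hw n).dRho.memLp 2).integrable_sq (hφ.dRho.memLp 2).integrable_sq
        fun x => hφ.fderiv_sqrt_sq_add_sq_sub_sq_le (hε n) x (1, 0)
    · exact integral_mono ((hw n).dSigma.memLp 2).integrable_sq (hφ.dSigma.memLp 2).integrable_sq
        fun x => hφ.fderiv_sqrt_sq_add_sq_sub_sq_le (hε n) x (0, 1)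
    · refine integral_mono (hw n).formDomain.integrable_potential
        hφ.formDomain.integrable_potential fun x => ?_
      obtain ⟨h1, h2, -⟩ := sqrt_sq_add_sq_sub_bounds (φ x) (hε n)
      refine mul_le_mul_of_nonneg_left ?_ (harmonicPotential_nonneg x)
      rw [← sq_abs (φ x)]
      exact pow_le_pow_left₀ h1 h2 2

/-- Taking absolute values preserves the form domain and does not increase energy. -/
theorem FormDomain.exists_abs {u p q : ℝ × ℝ → ℝ} (h : FormDomain u p q) :
    ∃ p' q' : ℝ × ℝ → ℝ, FormDomain (fun x => |u x|) p' q' ∧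
      formEnergy (fun x => |u x|) p' q' ≤ formEnergy u p q := by
  obtain ⟨φ, hφ, h1, h2, h3, h4⟩ := h.exists_test_seq_tendsto
  choose p' q' hf hE using fun n => (hφ n).exists_formDomain_abs
  have l2 := tendsto_integral_sq_of_tendsto (fun n => (hφ n).dRho.memLp 2) h.memLp_rho h2
  have l3 := tendsto_integral_sq_of_tendsto (fun n => (hφ n).dSigma.memLp 2) h.memLp_sigma h3
  have l4 := tendsto_integral_sq_of_tendsto (fun n => (hφ n).formDomain.memLp_potential)
    h.memLp_potential (h4.congr fun n => by
      refine integral_congr_ae (ae_of_all _ fun x => ?_)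
      simp only
      rw [← FormDomain.sqrt_potential_mul_sq (fun x => φ n x - u x), mul_sub])
  simp only [FormDomain.sqrt_potential_mul_sq] at l4
  -- The absolute value is 1-Lipschitz, so |φ_n| → |u| in `L²`, and closedness of the form carries
  -- the energy bound to the limit.
  refine exists_formDomain_of_tendsto hf h.memLp.abs ?_ hE ((l2.add l3).add l4)
  refine squeeze_zero (fun n => integral_sq_nonneg _) (fun n => ?_) h1
  refine integral_mono (((hφ n).memLp 2).abs.sub_two h.memLp.abs).integrable_sq
    (((hφ n).memLp 2).sub_two h.memLp).integrable_sq fun x => ?_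
  exact sq_le_sq.2 (abs_abs_sub_abs_le_abs_sub (φ n x) (u x))

end AbsoluteValue

/-! ### The quartic term -/

section Quartic

variable {u p q : ℝ × ℝ → ℝ}

theorem FormDomain.memLp_sq (h : FormDomain u p q) : MemLp (fun x => u x ^ 2) 2 volume := by
  obtain ⟨K, -, hK⟩ := exists_integral_pow_four_le
  exact (hK u p q h).1

theorem FormDomain.integrable_pow_four (h : FormDomain u p q) : Integrable fun x => u x ^ 4 := by
  have := h.memLp_sq.integrable_sq
  simpa only [← pow_mul] using this

theorem FormDomain.energyJ_eq (h : FormDomain u p q) (b : ℝ) :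
    energyJ b u p q = formEnergy u p q + b / 2 * ∫ x, u x ^ 4 := by
  have i1 := h.memLp_rho.integrable_sq
  have i2 := h.memLp_sigma.integrable_sq
  have i3 := h.integrable_potential
  have i4 := h.integrable_pow_four.const_mul (b / 2)
  have i12 : Integrable fun x => p x ^ 2 + q x ^ 2 := i1.add i2
  have i123 : Integrable fun x => p x ^ 2 + q x ^ 2 + harmonicPotential x * u x ^ 2 := i12.add i3
  rw [energyJ, formEnergy, integral_add i123 i4, integral_add i12 i3, integral_add i1 i2,
    integral_const_mul]

/-- Ladyzhenskaya's inequality for the difference: its `L²` norm tends to 0 while its gradient stays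
bounded. -/
theorem FormDomain.tendsto_integral_sub_pow_four {ι : Type*} {l : Filter ι}
    {v r s : ι → ℝ × ℝ → ℝ} (h : FormDomain u p q) (hv : ∀ n, FormDomain (v n) (r n) (s n)) {C : ℝ}
    (hC : ∀ n, formEnergy (v n) (r n) (s n) ≤ C)
    (hlim : Tendsto (fun n => ∫ x, (v n x - u x) ^ 2) l (𝓝 0)) :
    Tendsto (fun n => ∫ x, (v n x - u x) ^ 4) l (𝓝 0) := by
  obtain ⟨K, hK0, hK⟩ := exists_integral_pow_four_le
  have h1 := (hlim.const_mul K).mul_const (2 * C + 2 * ((∫ x, p x ^ 2) + ∫ x, q x ^ 2))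
  rw [mul_zero, zero_mul] at h1
  refine squeeze_zero (fun n => integral_nonneg fun x => by positivity) (fun n => ?_) h1
  refine (hK _ _ _ ((hv n).sub h)).2.trans ?_
  refine mul_le_mul_of_nonneg_left ?_ (mul_nonneg hK0 (integral_sq_nonneg _))
  have h2 := integral_sq_add_le (hv n).memLp_rho h.memLp_rho.neg
  have h3 := integral_sq_add_le (hv n).memLp_sigma h.memLp_sigma.neg
  simp only [Pi.neg_apply, even_two, Even.neg_pow, ← sub_eq_add_neg] at h2 h3
  have h4 := (integral_grad_sq_le_formEnergy _ _ _).trans (hC n)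
  linarith

theorem tendsto_integral_mul_sub_sq {ι : Type*} {l : Filter ι} {v : ι → ℝ × ℝ → ℝ}
    (hu : MemLp (fun x => u x ^ 2) 2 volume) (hv : ∀ n, MemLp (fun x => (v n x - u x) ^ 2) 2 volume)
    (hlim : Tendsto (fun n => ∫ x, (v n x - u x) ^ 4) l (𝓝 0)) :
    Tendsto (fun n => ∫ x, u x ^ 2 * (v n x - u x) ^ 2) l (𝓝 0) := by
  have h1 := (hlim.sqrt).const_mul (√(∫ x, u x ^ 4))
  rw [Real.sqrt_zero, mul_zero] at h1
  refine squeeze_zero (fun n => integral_nonneg fun x => by positivity) (fun n => ?_) h1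
  have := (le_abs_self _).trans (abs_integral_mul_le hu (hv n))
  simpa only [← pow_mul] using this

/-- The quartic term is continuous along energy bounded `L²` convergent families. -/
theorem FormDomain.tendsto_integral_pow_four {ι : Type*} {l : Filter ι}
    {v r s : ι → ℝ × ℝ → ℝ} (h : FormDomain u p q) (hv : ∀ n, FormDomain (v n) (r n) (s n)) {C : ℝ}
    (hC : ∀ n, formEnergy (v n) (r n) (s n) ≤ C)
    (hlim : Tendsto (fun n => ∫ x, (v n x - u x) ^ 2) l (𝓝 0)) :
    Tendsto (fun n => ∫ x, v n x ^ 4) l (𝓝 (∫ x, u x ^ 4)) := by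
  have h4 := h.tendsto_integral_sub_pow_four hv hC hlim
  have hd := fun n => ((hv n).sub h).memLp_sq
  have h2 := tendsto_integral_mul_sub_sq h.memLp_sq hd h4
  -- With s = v - u, (v² - u²)² = (s² + 2us)² ≤ 2s⁴ + 8u²s².
  have h5 : Tendsto (fun n => ∫ x, (v n x ^ 2 - u x ^ 2) ^ 2) l (𝓝 0) := by
    have h6 := (h4.const_mul 2).add (h2.const_mul 8)
    simp only [mul_zero, add_zero] at h6
    refine squeeze_zero (fun n => integral_sq_nonneg _) (fun n => ?_) h6
    have i1 := ((hv n).sub h).integrable_pow_four.const_mul 2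
    have i2 := (h.memLp_sq.integrable_mul_two (hd n)).const_mul 8
    rw [← integral_const_mul, ← integral_const_mul, ← integral_add i1 i2]
    refine integral_mono ((hv n).memLp_sq.sub_two h.memLp_sq).integrable_sq (i1.add i2)
      fun x => ?_
    simp only
    nlinarith [sq_nonneg ((v n x - u x) ^ 2 - 2 * u x * (v n x - u x))]
  have h7 := tendsto_integral_sq_of_tendsto (fun n => (hv n).memLp_sq) h.memLp_sq h5
  simpa only [← pow_mul] using h7

end Quartic

/-! ### Existence of a nonnegative minimiser -/

/-- The polynomial vanishes at 0, so it has a local minimum there and its derivative is zero. This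
is the first-order condition behind the Euler-Lagrange equation. -/
theorem eq_zero_of_eventually_quartic_nonneg {c₁ c₂ c₃ c₄ : ℝ}
    (h : ∀ᶠ t in 𝓝 (0 : ℝ), 0 ≤ c₁ * t + c₂ * t ^ 2 + c₃ * t ^ 3 + c₄ * t ^ 4) : c₁ = 0 := by
  have hd : HasDerivAt (fun t : ℝ => c₁ * t + c₂ * t ^ 2 + c₃ * t ^ 3 + c₄ * t ^ 4) c₁ 0 := by
    refine HasDerivAt.congr_deriv (((((hasDerivAt_id' (0 : ℝ)).const_mul c₁).fun_add
      ((hasDerivAt_pow 2 (0 : ℝ)).const_mul c₂)).fun_add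
      ((hasDerivAt_pow 3 (0 : ℝ)).const_mul c₃)).fun_add
      ((hasDerivAt_pow 4 (0 : ℝ)).const_mul c₄)) ?_
    simp
  refine IsLocalMin.hasDerivAt_eq_zero (f := fun t : ℝ =>
    c₁ * t + c₂ * t ^ 2 + c₃ * t ^ 3 + c₄ * t ^ 4) ?_ hd
  filter_upwards [h] with t ht
  simpa using ht

/-- The functional `J(·, b)` is coercive for small `b`. -/
theorem exists_formEnergy_le_energyJ : ∃ c : ℝ, 0 < c ∧ ∀ b : ℝ, |b| ≤ c →
    ∀ u p q : ℝ × ℝ → ℝ, MemH u p q → formEnergy u p q / 2 ≤ energyJ b u p q := by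
  obtain ⟨K, hK0, hK⟩ := exists_integral_pow_four_le
  -- Chosen so that |b| K ≤ 1, whence |b| ∫ u⁴ is at most the form energy; the added 1 covers K = 0.
  refine ⟨1 / (K + 1), by positivity, fun b hb u p q h => ?_⟩
  have h1 := (hK u p q h.formDomain).2
  rw [h.integral_sq_eq_one, mul_one] at h1
  have h2 := h1.trans (mul_le_mul_of_nonneg_left (integral_grad_sq_le_formEnergy u p q) hK0)
  have h3 : 0 ≤ ∫ x, u x ^ 4 := integral_nonneg fun x => by positivity
  have h4 : |b| * (∫ x, u x ^ 4) ≤ formEnergy u p q := by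
    calc |b| * (∫ x, u x ^ 4) ≤ 1 / (K + 1) * (K * formEnergy u p q) := by gcongr
      _ = K / (K + 1) * formEnergy u p q := by ring
      _ ≤ formEnergy u p q := mul_le_of_le_one_left (formEnergy_nonneg _ _ _)
          (div_le_one_of_le₀ (by linarith) (by positivity))
  have h5 : -(|b| * ∫ x, u x ^ 4) ≤ b * ∫ x, u x ^ 4 := by
    rw [← neg_mul]
    exact mul_le_mul_of_nonneg_right (neg_abs_le b) h3
  rw [h.formDomain.energyJ_eq]
  linarith

theorem memH_gaussianU0 : MemH gaussianU0 (fun x => -2 * (x.1 * gaussianU0 x))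
    (fun x => -(x.2 * gaussianU0 x)) :=
  formDomain_gaussianU0.memH integral_gaussianU0_sq

theorem energyJ_gaussianU0 (b : ℝ) : energyJ b gaussianU0 (fun x => -2 * (x.1 * gaussianU0 x))
    (fun x => -(x.2 * gaussianU0 x)) = 3 + b / 2 * (√2 / (2 * Real.pi)) := by
  rw [formDomain_gaussianU0.energyJ_eq, formEnergy_gaussianU0, integral_gaussianU0_pow_four]

/-- A nonnegative minimiser of `J(·, b)` exists for small `b`. -/
theorem exists_nonneg_minimizer {c : ℝ} (hc : ∀ b : ℝ, |b| ≤ c →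
    ∀ u p q : ℝ × ℝ → ℝ, MemH u p q → formEnergy u p q / 2 ≤ energyJ b u p q) {b : ℝ}
    (hb : |b| ≤ c) : ∃ v p q : ℝ × ℝ → ℝ, (∀ x, 0 ≤ v x) ∧ MemH v p q ∧
      ∀ u p' q' : ℝ × ℝ → ℝ, MemH u p' q' → energyJ b v p q ≤ energyJ b u p' q' := by
  let S : Set ℝ := {j | ∃ u p q : ℝ × ℝ → ℝ, MemH u p q ∧ energyJ b u p q = j}
  have hne : S.Nonempty := ⟨_, _, _, _, memH_gaussianU0, rfl⟩
  have hbdd : BddBelow S := by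
    refine ⟨0, ?_⟩
    rintro j ⟨u, p, q, h, rfl⟩
    exact (div_nonneg (formEnergy_nonneg u p q) zero_le_two).trans (hc b hb u p q h)
  obtain ⟨j, -, hj, hjS⟩ := exists_seq_tendsto_sInf hne hbdd
  choose u p q hH hJ using hjS
  have hmin : ∀ w r s : ℝ × ℝ → ℝ, MemH w r s → sInf S ≤ energyJ b w r s := fun w r s h =>
    csInf_le hbdd ⟨w, r, s, h, rfl⟩
  obtain ⟨B, hB⟩ := hj.bddAbove_range
  have hE : ∀ n, formEnergy (u n) (p n) (q n) ≤ 2 * B := fun n => by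
    have h1 := hc b hb _ _ _ (hH n)
    have h2 := hB (Set.mem_range_self n)
    rw [hJ n] at h1
    linarith
  obtain ⟨u₀, p₀, q₀, h₀, ns, hns, hl, hlsc⟩ := exists_subseq_tendsto_of_formNormSq_le
    (fun n => (hH n).formDomain) (C := 1 + 2 * B) fun n => by
      rw [formNormSq_eq, (hH n).integral_sq_eq_one]
      linarith [hE n]
  have hone : ∫ x, u₀ x ^ 2 = 1 := by
    have h1 := tendsto_integral_sq_of_tendsto (fun n => (hH (ns n)).memLp) h₀.memLp hl
    simp only [(hH _).integral_sq_eq_one] at h1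
    exact tendsto_nhds_unique h1 tendsto_const_nhds
  have h4 := h₀.tendsto_integral_pow_four (fun n => (hH (ns n)).formDomain)
    (fun n => hE (ns n)) hl
  -- The quadratic part is lower semicontinuous and the quartic part converges, so the sign of b
  -- does not matter.
  have hle : formEnergy u₀ p₀ q₀ + b / 2 * ∫ x, u₀ x ^ 4 ≤ sInf S := by
    refine le_of_forall_pos_le_add fun δ hδ => ?_
    have h5 : Tendsto (fun n => j (ns n) - b / 2 * ∫ x, u (ns n) x ^ 4) atTop
        (𝓝 (sInf S - b / 2 * ∫ x, u₀ x ^ 4)) :=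
      (hj.comp hns.tendsto_atTop).sub (h4.const_mul _)
    have h6 : formEnergy u₀ p₀ q₀ ≤ sInf S - b / 2 * (∫ x, u₀ x ^ 4) + δ := by
      refine ge_of_tendsto (h5.add_const δ) ?_
      filter_upwards [hlsc δ hδ] with n hn
      rw [← hJ (ns n), (hH (ns n)).formDomain.energyJ_eq]
      linarith
    linarith
  -- Passing to |u₀| preserves the norm and the quartic term and does not raise the quadratic form.
  obtain ⟨p', q', habs, hEabs⟩ := h₀.exists_abs
  have hH' : MemH (fun x => |u₀ x|) p' q' := habs.memH (by simpa only [sq_abs] using hone)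
  refine ⟨fun x => |u₀ x|, p', q', fun x => abs_nonneg _, hH', fun w r s hw => ?_⟩
  refine le_trans ?_ (hmin w r s hw)
  rw [habs.energyJ_eq]
  have h7 : ∀ x, |u₀ x| ^ 4 = u₀ x ^ 4 := fun x => by
    rw [show 4 = 2 * 2 by norm_num, pow_mul, sq_abs, ← pow_mul]
  simp only [h7]
  linarith

/-! ### The Euler-Lagrange equation and the multiplier -/

section Variation

variable {v p q φ : ℝ × ℝ → ℝ}

theorem integral_add_mul_sq {f g : ℝ × ℝ → ℝ} (hf : MemLp f 2 volume) (hg : MemLp g 2 volume)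
    (t : ℝ) : ∫ x, (f x + t * g x) ^ 2 =
      (∫ x, f x ^ 2) + 2 * t * (∫ x, f x * g x) + t ^ 2 * ∫ x, g x ^ 2 := by
  have i1 := hf.integrable_sq
  have i2 := (hf.integrable_mul_two hg).const_mul (2 * t)
  have i3 := hg.integrable_sq.const_mul (t ^ 2)
  have i12 : Integrable fun x => f x ^ 2 + 2 * t * (f x * g x) := i1.add i2
  rw [← integral_const_mul, ← integral_const_mul, ← integral_add i1 i2, ← integral_add i12 i3]
  exact integral_congr_ae (ae_of_all _ fun x => by ring)

theorem FormDomain.integrable_pow_three_mul (h : FormDomain v p q) (hφ : IsTestFunction φ) :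
    Integrable fun x => v x ^ 3 * φ x := by
  refine (h.memLp_sq.integrable_mul_two (hφ.mul_memLp h.memLp)).congr (ae_of_all _ fun x => ?_)
  simp only
  ring

theorem FormDomain.integral_add_mul_pow_four (h : FormDomain v p q) (hφ : IsTestFunction φ)
    (t : ℝ) : ∫ x, (v x + t * φ x) ^ 4 = (∫ x, v x ^ 4) + 4 * t * (∫ x, v x ^ 3 * φ x) +
      6 * t ^ 2 * (∫ x, v x ^ 2 * φ x ^ 2) + 4 * t ^ 3 * (∫ x, v x * φ x ^ 3) +
      t ^ 4 * ∫ x, φ x ^ 4 := by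
  have hφ2 : IsTestFunction fun x => φ x ^ 2 := by
    simpa only [sq] using hφ.smooth_mul hφ.1
  have hφ3 : IsTestFunction fun x => φ x ^ 3 := by
    simpa only [← pow_succ'] using hφ2.smooth_mul hφ.1
  have j1 := h.integrable_pow_four
  have j2 := h.integrable_pow_three_mul hφ
  have j3 := h.memLp_sq.integrable_mul_two (hφ2.memLp 2)
  have j4 := h.memLp.integrable_mul_two (hφ3.memLp 2)
  have j5 := hφ.formDomain.integrable_pow_four
  have k2 := j2.const_mul (4 * t)
  have k3 := j3.const_mul (6 * t ^ 2)
  have k4 := j4.const_mul (4 * t ^ 3)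
  have k5 := j5.const_mul (t ^ 4)
  have k12 : Integrable fun x => v x ^ 4 + 4 * t * (v x ^ 3 * φ x) := j1.add k2
  have k123 : Integrable fun x => v x ^ 4 + 4 * t * (v x ^ 3 * φ x) +
      6 * t ^ 2 * (v x ^ 2 * φ x ^ 2) := k12.add k3
  have k1234 : Integrable fun x => v x ^ 4 + 4 * t * (v x ^ 3 * φ x) +
      6 * t ^ 2 * (v x ^ 2 * φ x ^ 2) + 4 * t ^ 3 * (v x * φ x ^ 3) := k123.add k4
  rw [← integral_const_mul, ← integral_const_mul, ← integral_const_mul, ← integral_const_mul,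
    ← integral_add j1 k2, ← integral_add k12 k3, ← integral_add k123 k4, ← integral_add k1234 k5]
  exact integral_congr_ae (ae_of_all _ fun x => by ring)

theorem FormDomain.formEnergy_add_mul (h : FormDomain v p q) (hφ : IsTestFunction φ) (t : ℝ) :
    formEnergy (fun x => v x + t * φ x) (fun x => p x + t * dRho φ x)
      (fun x => q x + t * dSigma φ x) = formEnergy v p q +
      2 * t * ((∫ x, p x * dRho φ x) + (∫ x, q x * dSigma φ x) +
        ∫ x, harmonicPotential x * v x * φ x) + t ^ 2 * formEnergy φ (dRho φ) (dSigma φ) := by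
  have e1 := integral_add_mul_sq h.memLp_rho (hφ.dRho.memLp 2) t
  have e2 := integral_add_mul_sq h.memLp_sigma (hφ.dSigma.memLp 2) t
  have e3 := integral_add_mul_sq h.memLp_potential hφ.formDomain.memLp_potential t
  have e4 : ∀ x, (√(harmonicPotential x) * v x + t * (√(harmonicPotential x) * φ x)) ^ 2 =
      harmonicPotential x * (v x + t * φ x) ^ 2 := fun x => by
    rw [← FormDomain.sqrt_potential_mul_sq (fun x => v x + t * φ x)]
    ring
  have e5 : ∀ x, √(harmonicPotential x) * v x * (√(harmonicPotential x) * φ x) =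
      harmonicPotential x * v x * φ x := fun x => by
    have := Real.mul_self_sqrt (harmonicPotential_nonneg x)
    linear_combination (v x * φ x) * this
  simp only [e4, e5, FormDomain.sqrt_potential_mul_sq] at e3
  unfold formEnergy
  rw [e1, e2, e3]
  ring

theorem formEnergy_const_mul (c : ℝ) (u p q : ℝ × ℝ → ℝ) :
    formEnergy (fun x => c * u x) (fun x => c * p x) (fun x => c * q x) =
      c ^ 2 * formEnergy u p q := by
  have e : ∀ x, harmonicPotential x * (c * u x) ^ 2 = c ^ 2 * (harmonicPotential x * u x ^ 2) :=
    fun x => by ring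
  simp only [formEnergy, e]
  simp only [mul_pow, integral_const_mul]
  ring

/-- Homogeneous form of the minimality inequality. -/
theorem FormDomain.mul_sq_le_of_minimizer {u p' q' : ℝ × ℝ → ℝ} {b m : ℝ}
    (hmin : ∀ u p' q' : ℝ × ℝ → ℝ, MemH u p' q' → m ≤ energyJ b u p' q')
    (hu : FormDomain u p' q') (hN : 0 < ∫ x, u x ^ 2) :
    m * (∫ x, u x ^ 2) ^ 2 ≤ (∫ x, u x ^ 2) * formEnergy u p' q' + b / 2 * ∫ x, u x ^ 4 := by
  set N := ∫ x, u x ^ 2 with hNdef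
  -- Minimality is applied to u/√N and multiplied by N², which leaves an inequality polynomial in t
  -- along u = v + tφ.
  set c := (√N)⁻¹
  have hc2 : c ^ 2 = N⁻¹ := by rw [inv_pow, Real.sq_sqrt hN.le]
  have hc4 : c ^ 4 = (N ^ 2)⁻¹ := by
    rw [show 4 = 2 * 2 by norm_num, pow_mul, hc2, inv_pow]
  have h1 := hu.const_mul c
  have h2 : ∫ x, (c * u x) ^ 2 = 1 := by
    simp only [mul_pow]
    rw [integral_const_mul, hc2, ← hNdef, inv_mul_cancel₀ hN.ne']
  have h3 := hmin _ _ _ (h1.memH h2)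
  rw [h1.energyJ_eq, formEnergy_const_mul, hc2] at h3
  simp only [mul_pow, integral_const_mul, hc4] at h3
  have h4 := mul_le_mul_of_nonneg_right h3 (sq_nonneg N)
  have hN' := hN.ne'
  calc m * N ^ 2 ≤ _ := h4
    _ = _ := by field_simp

theorem FormDomain.integral_weakForm_left (h : FormDomain v p q) (hφ : IsTestFunction φ) :
    ∫ x, (p x * dRho φ x + q x * dSigma φ x + harmonicPotential x * v x * φ x) =
      (∫ x, p x * dRho φ x) + (∫ x, q x * dSigma φ x) + ∫ x, harmonicPotential x * v x * φ x := by
  have i1 := h.memLp_rho.integrable_mul_two (hφ.dRho.memLp 2)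
  have i2 := h.memLp_sigma.integrable_mul_two (hφ.dSigma.memLp 2)
  have i3 : Integrable fun x => harmonicPotential x * v x * φ x := by
    refine (h.memLp.integrable_mul_two
      (hφ.continuous_mul_memLp continuous_harmonicPotential 2)).congr (ae_of_all _ fun x => ?_)
    simp only
    ring
  have i12 : Integrable fun x => p x * dRho φ x + q x * dSigma φ x := i1.add i2
  rw [integral_add i12 i3, integral_add i1 i2]

theorem FormDomain.integral_weakForm_right (h : FormDomain v p q) (hφ : IsTestFunction φ)
    (E b : ℝ) : ∫ x, (E * v x - b * v x ^ 3) * φ x =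
      E * (∫ x, v x * φ x) - b * ∫ x, v x ^ 3 * φ x := by
  have i1 := (h.memLp.integrable_mul_two (hφ.memLp 2)).const_mul E
  have i2 := (h.integrable_pow_three_mul hφ).const_mul b
  rw [← integral_const_mul, ← integral_const_mul, ← integral_sub i1 i2]
  exact integral_congr_ae (ae_of_all _ fun x => by ring)

/-- The Euler-Lagrange equation of a minimiser. -/
theorem MemH.isWeakSolution_of_minimizer {b : ℝ} (h : MemH v p q)
    (hmin : ∀ u p' q' : ℝ × ℝ → ℝ, MemH u p' q' → energyJ b v p q ≤ energyJ b u p' q') :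
    IsWeakSolution b (formEnergy v p q + b * ∫ x, v x ^ 4) v p q := by
  intro φ hφ
  have hf := h.formDomain
  have hφm := hφ.memLp 2
  rw [hf.integral_weakForm_left hφ, hf.integral_weakForm_right hφ]
  set D := (∫ x, p x * dRho φ x) + (∫ x, q x * dSigma φ x) +
    ∫ x, harmonicPotential x * v x * φ x with hD
  set A := ∫ x, v x * φ x with hA
  set B := ∫ x, φ x ^ 2 with hB
  set E₀ := formEnergy v p q with hE₀
  set E₁ := formEnergy φ (dRho φ) (dSigma φ) with hE₁
  set F₀ := ∫ x, v x ^ 4 with hF₀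
  set F₁ := ∫ x, v x ^ 3 * φ x with hF₁
  set F₂ := ∫ x, v x ^ 2 * φ x ^ 2 with hF₂
  set F₃ := ∫ x, v x * φ x ^ 3 with hF₃
  set F₄ := ∫ x, φ x ^ 4 with hF₄
  have hNt : ∀ t : ℝ, ∫ x, (v x + t * φ x) ^ 2 = 1 + 2 * t * A + t ^ 2 * B := fun t => by
    rw [integral_add_mul_sq h.memLp hφm, h.integral_sq_eq_one]
  have hcont : Tendsto (fun t : ℝ => 1 + 2 * t * A + t ^ 2 * B) (𝓝 0) (𝓝 1) := by
    have : Continuous fun t : ℝ => 1 + 2 * t * A + t ^ 2 * B := by fun_prop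
    simpa using this.tendsto 0
  -- With N(t) = ∫ (v + tφ)², these are the coefficients of N(t) Q(v + tφ) + (b/2) ∫ (v + tφ)⁴ -
  -- J(v, b) N(t)². The constant term cancels since N(0) = 1, and vanishing of the linear one is the
  -- weak equation.
  have hev : ∀ᶠ t in 𝓝 (0 : ℝ), 0 ≤
      (2 * A * E₀ + 2 * D + 2 * b * F₁ - 4 * (E₀ + b / 2 * F₀) * A) * t +
      (B * E₀ + 4 * A * D + E₁ + 3 * b * F₂ - (E₀ + b / 2 * F₀) * (4 * A ^ 2 + 2 * B)) * t ^ 2 +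
      (2 * A * E₁ + 2 * B * D + 2 * b * F₃ - (E₀ + b / 2 * F₀) * (4 * A * B)) * t ^ 3 +
      (B * E₁ + b / 2 * F₄ - (E₀ + b / 2 * F₀) * B ^ 2) * t ^ 4 := by
    filter_upwards [hcont.eventually_const_lt zero_lt_one] with t ht
    have h1 := FormDomain.mul_sq_le_of_minimizer hmin (hf.add (hφ.formDomain.const_mul t))
      (by rw [hNt]; exact ht)
    rw [hNt, hf.formEnergy_add_mul hφ, hf.integral_add_mul_pow_four hφ, hf.energyJ_eq] at h1
    linarith
  have h0 := eq_zero_of_eventually_quartic_nonneg hev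
  linarith

end Variation

theorem exists_isGroundState : ∃ c : ℝ, 0 < c ∧ ∀ b : ℝ, |b| ≤ c →
    ∃ (v : ℝ × ℝ → ℝ) (E : ℝ), IsGroundState b v E := by
  obtain ⟨c, hc0, hc⟩ := exists_formEnergy_le_energyJ
  refine ⟨c, hc0, fun b hb => ?_⟩
  obtain ⟨v, p, q, hv, hH, hmin⟩ := exists_nonneg_minimizer hc hb
  exact ⟨v, _, ae_of_all _ hv, p, q, hH, hmin, hH.isWeakSolution_of_minimizer hmin⟩

/-- The Lagrange multiplier is determined by the solution. -/
theorem MemH.multiplier_eq {b E : ℝ} {v p q : ℝ × ℝ → ℝ} (h : MemH v p q)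
    (hs : IsWeakSolution b E v p q) : E = formEnergy v p q + b * ∫ x, v x ^ 4 := by
  have hf := h.formDomain
  -- The equation is to be tested with v, which need not be a test function, so a sequence φ_n → v
  -- is used. The cubic term passes to the limit as the pairing of v² with vφ_n, which converges in
  -- `L²`.
  obtain ⟨φ, hφ, h1, h2, h3, h4⟩ := hf.exists_test_seq_tendsto
  have hm := fun n => (hφ n).memLp 2
  have h4' : Tendsto (fun n => ∫ x, (√(harmonicPotential x) * φ n x -
      √(harmonicPotential x) * v x) ^ 2) atTop (𝓝 0) := by
    refine h4.congr fun n => integral_congr_ae (ae_of_all _ fun x => ?_)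
    simp only
    rw [← FormDomain.sqrt_potential_mul_sq (fun x => φ n x - v x), mul_sub]
  have hpair : ∀ {f : ℝ × ℝ → ℝ} {g : ℕ → ℝ × ℝ → ℝ} {g₀ : ℝ × ℝ → ℝ}, MemLp f 2 volume →
      (∀ n, MemLp (g n) 2 volume) → MemLp g₀ 2 volume →
      Tendsto (fun n => ∫ x, (g n x - g₀ x) ^ 2) atTop (𝓝 0) →
      Tendsto (fun n => ∫ x, f x * g n x) atTop (𝓝 (∫ x, f x * g₀ x)) :=
    fun {f _ _} hf hg hg₀ hlim => tendsto_integral_mul_of_tendsto (f := fun _ => f) (fun _ => hf)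
      hg hf hg₀ (by simp) hlim
  have l1 := hpair hf.memLp hm hf.memLp h1
  have l2 := hpair hf.memLp_rho (fun n => (hφ n).dRho.memLp 2) hf.memLp_rho h2
  have l3 := hpair hf.memLp_sigma (fun n => (hφ n).dSigma.memLp 2) hf.memLp_sigma h3
  have l4 := hpair hf.memLp_potential (fun n => (hφ n).formDomain.memLp_potential)
    hf.memLp_potential h4'
  have e5 : ∀ (f : ℝ × ℝ → ℝ) x, √(harmonicPotential x) * v x * (√(harmonicPotential x) * f x) =
      harmonicPotential x * v x * f x := fun f x => by
    have := Real.mul_self_sqrt (harmonicPotential_nonneg x)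
    linear_combination (v x * f x) * this
  simp only [e5] at l4
  have hEn := ((tendsto_integral_sq_of_tendsto (fun n => (hφ n).dRho.memLp 2) hf.memLp_rho h2).add
    (tendsto_integral_sq_of_tendsto (fun n => (hφ n).dSigma.memLp 2) hf.memLp_sigma h3)).add
    (tendsto_integral_sq_of_tendsto (fun n => (hφ n).formDomain.memLp_potential)
      hf.memLp_potential h4')
  simp only [FormDomain.sqrt_potential_mul_sq] at hEn
  obtain ⟨C, hC⟩ := hEn.bddAbove_range
  have hd4 := hf.tendsto_integral_sub_pow_four (fun n => (hφ n).formDomain) (C := C)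
    (fun n => hC (Set.mem_range_self n)) h1
  have hd2 := tendsto_integral_mul_sub_sq hf.memLp_sq
    (fun n => ((hφ n).formDomain.sub hf).memLp_sq) hd4
  have hvφ : ∀ n, MemLp (fun x => v x * φ n x) 2 volume := fun n => by
    simpa only [mul_comm] using (hφ n).mul_memLp hf.memLp
  have l5 := hpair hf.memLp_sq hvφ hf.memLp_sq (hd2.congr fun n =>
    integral_congr_ae (ae_of_all _ fun x => by simp only; ring))
  have e6 : ∀ (f : ℝ × ℝ → ℝ) x, v x ^ 2 * (v x * f x) = v x ^ 3 * f x := fun f x => by ring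
  simp only [e6] at l5
  have hL := (l2.add l3).add l4
  have hR := (l1.const_mul E).sub (l5.const_mul b)
  have heq := tendsto_nhds_unique (hL.congr fun n => by
    rw [← hf.integral_weakForm_left (hφ n), hs _ (hφ n), hf.integral_weakForm_right (hφ n)]) hR
  have e7 : ∀ x, harmonicPotential x * v x * v x = harmonicPotential x * v x ^ 2 := fun x => by ring
  have e8 : ∀ x, v x ^ 2 * v x ^ 2 = v x ^ 4 := fun x => by ring
  simp only [e7, e8, ← sq, h.integral_sq_eq_one] at heq
  unfold formEnergy
  linarith

/-! ### Asymptotics as the parameter tends to zero -/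

section Asymptotics

/-- Nonnegative normalised families whose energy tends to the ground state energy converge to the
Gaussian along a subsequence. -/
theorem exists_subseq_tendsto_gaussianU0 {u p q : ℕ → ℝ × ℝ → ℝ} {L : ℕ → ℝ}
    (h : ∀ n, MemH (u n) (p n) (q n)) (hpos : ∀ n, ∀ᵐ x, 0 ≤ u n x)
    (hE : ∀ n, formEnergy (u n) (p n) (q n) ≤ L n) (hL : Tendsto L atTop (𝓝 3)) :
    ∃ ns : ℕ → ℕ, Tendsto (fun n => ∫ x, (u (ns n) x - gaussianU0 x) ^ 2) atTop (𝓝 0) ∧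
      Tendsto (fun n => ∫ x, u (ns n) x ^ 4) atTop (𝓝 (√2 / (2 * Real.pi))) := by
  obtain ⟨B, hB⟩ := hL.bddAbove_range
  have hEB : ∀ n, formEnergy (u n) (p n) (q n) ≤ B := fun n =>
    (hE n).trans (hB (Set.mem_range_self n))
  obtain ⟨u₀, p₀, q₀, h₀, ns, hns, hl, hlsc⟩ := exists_subseq_tendsto_of_formNormSq_le
    (fun n => (h n).formDomain) (C := 1 + B) fun n => by
      rw [formNormSq_eq, (h n).integral_sq_eq_one]
      linarith [hEB n]
  have hone : ∫ x, u₀ x ^ 2 = 1 := by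
    have h1 := tendsto_integral_sq_of_tendsto (fun n => (h (ns n)).memLp) h₀.memLp hl
    simp only [(h _).integral_sq_eq_one] at h1
    exact tendsto_nhds_unique h1 tendsto_const_nhds
  have hpos₀ : ∀ᵐ x, 0 ≤ u₀ x := by
    obtain ⟨ms, -, hae⟩ := exists_subseq_tendsto_ae_of_tendsto (fun n => (h (ns n)).memLp)
      h₀.memLp hl
    filter_upwards [hae, ae_all_iff.2 hpos] with x hx hx'
    exact ge_of_tendsto' hx fun n => hx' _
  -- Lower semicontinuity puts the limit at the bottom of the form, where uniqueness identifies it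
  -- with the Gaussian.
  have hle : formEnergy u₀ p₀ q₀ ≤ 3 := by
    refine le_of_forall_pos_le_add fun δ hδ => ?_
    refine ge_of_tendsto ((hL.comp hns.tendsto_atTop).add_const δ) ?_
    filter_upwards [hlsc δ hδ] with n hn
    exact hn.trans (add_le_add_left (hE (ns n)) δ)
  have hae := h₀.ae_eq_gaussianU0 hone hpos₀ hle
  have hl' : Tendsto (fun n => ∫ x, (u (ns n) x - gaussianU0 x) ^ 2) atTop (𝓝 0) := by
    refine hl.congr fun n => integral_congr_ae ?_
    filter_upwards [hae] with x hx
    rw [hx]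
  refine ⟨ns, hl', ?_⟩
  rw [← integral_gaussianU0_pow_four]
  exact formDomain_gaussianU0.tendsto_integral_pow_four (fun n => (h (ns n)).formDomain)
    (fun n => hEB (ns n)) hl'

/-- Energy bound for a ground state by comparison with the Gaussian. -/
theorem formEnergy_sub_three_le {b : ℝ} {v p q : ℝ × ℝ → ℝ} (h : MemH v p q)
    (hmin : ∀ u p' q' : ℝ × ℝ → ℝ, MemH u p' q' → energyJ b v p q ≤ energyJ b u p' q') :
    formEnergy v p q - 3 ≤ b / 2 * (√2 / (2 * Real.pi) - ∫ x, v x ^ 4) := by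
  have h1 := hmin _ _ _ memH_gaussianU0
  rw [energyJ_gaussianU0, h.formDomain.energyJ_eq] at h1
  linarith

/-- The limit does not depend on the subsequence, so compactness gives full convergence. The two
quantities are paired so that one extraction serves both. -/
theorem tendsto_isGroundState {v₀ : ℝ → ℝ × ℝ → ℝ} {E₀ : ℝ → ℝ}
    (h : ∀ᶠ b in 𝓝 (0 : ℝ), IsGroundState b (v₀ b) (E₀ b)) :
    Tendsto (fun b => (∫ x, (v₀ b x - gaussianU0 x) ^ 2, ∫ x, v₀ b x ^ 4)) (𝓝 0)
      (𝓝 (0, √2 / (2 * Real.pi))) := by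
  obtain ⟨c, hc0, hc⟩ := exists_formEnergy_le_energyJ
  have hcb : ∀ᶠ b in 𝓝 (0 : ℝ), |b| ≤ c := by
    have := (continuous_abs (G := ℝ)).tendsto 0
    rw [abs_zero] at this
    exact (this.eventually_lt_const hc0).mono fun _ hb => hb.le
  refine tendsto_of_subseq_tendsto fun ns hns => ?_
  -- Shifting the sequence by N makes the ground state property and the smallness of b hold for
  -- every index; the reindexing asked for need not be increasing.
  obtain ⟨N, hN⟩ := eventually_atTop.1 (hns.eventually (h.and hcb))
  have hshift : Tendsto (fun n => ns (n + N)) atTop (𝓝 0) := hns.comp (tendsto_add_atTop_nat N)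
  have hgs := fun n => (hN (n + N) (Nat.le_add_left N n)).1
  have hb := fun n => (hN (n + N) (Nat.le_add_left N n)).2
  choose hpos p q hH hmin _ using hgs
  obtain ⟨K, hK0, hK⟩ := exists_integral_pow_four_le
  set M := √2 / (2 * Real.pi) with hM
  have hM0 : 0 ≤ M := by
    have := Real.pi_pos
    positivity
  -- Coercivity and comparison with the Gaussian: half of the form energy is at most 3 + (b/2) M,
  -- and b ≤ c.
  have hE : ∀ n, formEnergy (v₀ (ns (n + N))) (p n) (q n) ≤ 6 + c * M := fun n => by
    have h1 := (hc _ (hb n) _ _ _ (hH n)).trans (hmin n _ _ _ memH_gaussianU0)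
    rw [energyJ_gaussianU0, ← hM] at h1
    have h2 := mul_le_mul_of_nonneg_right ((le_abs_self _).trans (hb n)) hM0
    linarith
  have hF : ∀ n, ∫ x, v₀ (ns (n + N)) x ^ 4 ≤ K * (6 + c * M) := fun n => by
    have h1 := (hK _ _ _ (hH n).formDomain).2
    rw [(hH n).integral_sq_eq_one, mul_one] at h1
    exact h1.trans (mul_le_mul_of_nonneg_left
      ((integral_grad_sq_le_formEnergy _ _ _).trans (hE n)) hK0)
  have hL : Tendsto (fun n => 3 + |ns (n + N)| / 2 * (M + K * (6 + c * M))) atTop (𝓝 3) := by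
    have h1 := ((hshift.abs.div_const 2).mul_const (M + K * (6 + c * M))).const_add 3
    simpa using h1
  obtain ⟨ms, h1, h2⟩ := exists_subseq_tendsto_gaussianU0 hH hpos (fun n => by
    have h3 := formEnergy_sub_three_le (hH n) (hmin n)
    rw [← hM] at h3
    have h4 : 0 ≤ ∫ x, v₀ (ns (n + N)) x ^ 4 := integral_nonneg fun x => by positivity
    have h5 : ns (n + N) / 2 * (M - ∫ x, v₀ (ns (n + N)) x ^ 4) ≤
        |ns (n + N)| / 2 * (M + K * (6 + c * M)) := by
      refine (le_abs_self _).trans ?_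
      rw [abs_mul, abs_div, abs_two]
      refine mul_le_mul_of_nonneg_left (abs_le.2 ⟨?_, ?_⟩) (by positivity)
      · linarith [hF n]
      · linarith [hF n]
    linarith) hL
  exact ⟨fun n => ms n + N, h1.prodMk_nhds h2⟩

theorem tendsto_eLpNorm_isGroundState {v₀ : ℝ → ℝ × ℝ → ℝ} {E₀ : ℝ → ℝ}
    (h : ∀ᶠ b in 𝓝 (0 : ℝ), IsGroundState b (v₀ b) (E₀ b)) :
    Tendsto (fun b => eLpNorm (v₀ b - gaussianU0) 2 volume) (𝓝 0) (𝓝 0) := by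
  have h1 := ENNReal.tendsto_ofReal ((tendsto_isGroundState h).fst_nhds.sqrt)
  simp only [Real.sqrt_zero, ENNReal.ofReal_zero] at h1
  refine h1.congr' ?_
  filter_upwards [h] with b hb
  obtain ⟨-, p, q, hH, -⟩ := hb
  rw [eLpNorm_two_eq_ofReal_sqrt_integral (hH.memLp.sub memLp_gaussianU0)]
  rfl

/-- With F = ∫ v⁴, the error is (Q(v) - 3) + b(F - M), where 0 ≤ Q(v) - 3 ≤ (b/2)(M - F). Both terms
are bounded by |b| |F - M|, and F → M. -/
theorem isLittleO_multiplier_sub {v₀ : ℝ → ℝ × ℝ → ℝ} {E₀ : ℝ → ℝ}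
    (h : ∀ᶠ b in 𝓝 (0 : ℝ), IsGroundState b (v₀ b) (E₀ b)) :
    (fun b => E₀ b - (3 + √2 / (2 * Real.pi) * b)) =o[𝓝 0] (fun b => b) := by
  rw [isLittleO_iff]
  intro ε hε
  have h1 := (tendsto_isGroundState h).snd_nhds
  filter_upwards [h, Metric.tendsto_nhds.1 h1 (ε / 2) (half_pos hε)] with b hb hd
  obtain ⟨-, p, q, hH, hmin, hs⟩ := hb
  rw [Real.dist_eq] at hd
  set M := √2 / (2 * Real.pi) with hM
  set F := ∫ x, v₀ b x ^ 4 with hF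
  have h2 := formEnergy_sub_three_le hH hmin
  rw [← hM, ← hF] at h2
  have h3 := hH.formDomain.three_mul_integral_sq_le
  rw [hH.integral_sq_eq_one, mul_one] at h3
  have h4 := hH.multiplier_eq hs
  rw [← hF] at h4
  have h5 : |b * (F - M)| ≤ |b| * (ε / 2) := by
    rw [abs_mul]
    gcongr
  have h6 := abs_le.1 h5
  rw [Real.norm_eq_abs, Real.norm_eq_abs, h4]
  refine abs_le.2 ⟨?_, ?_⟩
  · have h7 : 0 ≤ ε * |b| := by positivity
    linarith [h6.1]
  · linarith [h6.1, h6.2]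

end Asymptotics

end

theorem mainTheorem4 :
    (∃ c₀ : ℝ, 0 < c₀ ∧ ∀ a κ : ℝ, 0 < κ → |a| * κ ^ 2 ≤ c₀ →
      ∃ (v : ℝ × ℝ → ℝ) (E : ℝ), IsGroundState (a * κ ^ 2) v E) ∧
    ∀ (v₀ : ℝ → ℝ × ℝ → ℝ) (E₀ : ℝ → ℝ),
      (∀ᶠ b in 𝓝 (0 : ℝ), IsGroundState b (v₀ b) (E₀ b)) →
      Tendsto (fun b => eLpNorm (v₀ b - gaussianU0) 2 volume) (𝓝 0) (𝓝 0) ∧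
      (fun b => E₀ b - (3 + √2 / (2 * Real.pi) * b)) =o[𝓝 0] (fun b => b) := by
  refine ⟨?_, fun v₀ E₀ h => ⟨tendsto_eLpNorm_isGroundState h, isLittleO_multiplier_sub h⟩⟩
  obtain ⟨c, hc0, hc⟩ := exists_isGroundState
  refine ⟨c, hc0, fun a κ _ hle => hc _ ?_⟩
  rwa [abs_mul, abs_of_nonneg (sq_nonneg κ)]
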